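/- Let $n\ge 2$. Let $\mathbb Z^n$ act on $2^{\mathbb Z^n}=\{0,1\}^{\mathbb Z^n}$ (with the product topology) by the Bernoulli shift $(g\cdot z)(h)=z(h+g)$, and let $F(2^{\mathbb Z^n})=\{z : g\cdot z\ne z \text{ for all } g\in\mathbb Z^n\setminus\{0\}\}$ be its free part. An $n$-dimensional rectangle in $\mathbb Z^n$ is a set $S=\prod_{i=1}^n([a_i,b_i]\cap\mathbb Z)$ with integers $a_i<b_i$; write $S\cdot z=\{g\cdot z: g\in S\}$ and let $C_S=\bigcup_{x\in S}\prod_{i=1}^n[x_i-\tfrac12,x_i+\tfrac12]\subseteq\mathbb R^n$. Then there is a partition $\mathcal P$ of $F(2^{\mathbb Z^n})$ such that 1. every member of $\mathcal P$ is of the form $S\cdot z$ with $z\in F(2^{\mathbb Z^n})$ and $S$ an $n$-dimensional rectangle in $\mathbb Z^n$; 2. $\mathcal P$ is clopen: for every $g\in\mathbb Z^n$ the set of all $u\in F(2^{\mathbb Z^n})$ such that $u$ and $g\cdot u$ lie in the same member of $\mathcal P$ is relatively clopen in $F(2^{\mathbb Z^n})$; 3. $\mathcal P$ is $3\cdot 2^{n-2}$-regulated: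 for every $z\in F(2^{\mathbb Z^n})$ the family $\mathcal S_z=\{S\subseteq\mathbb Z^n: S\cdot z\in\mathcal P\}$ is a partition of $\mathbb Z^n$ into $n$-dimensional rectangles, and $\mathcal C_z=\{C_S: S\in\mathcal S_z\}$ is a regulated partition of $\mathbb R^n$ in which every point of $\mathbb R^n$ lies in at most $3\cdot2^{n-2}$ members of $\mathcal C_z$. Here a regulated partition of $\mathbb R^n$ is a set of rectangles $\prod_{i=1}^n[a_i,b_i]$, $a_i<b_i$, with union $\mathbb R^n$ and pairwise disjoint interiors, such that for some $d>0$ all the end points $a_i,b_i$ lie in one set $D\subseteq\mathbb R$ any two distinct elements of which are more than $d$ apart. -/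

import Mathlib

namespace RegPart

/-! ### Regulated partitions of `ℝⁿ` -/

/-- A regulated partition of `ℝⁿ`: a set of `n`-dimensional rectangles with disjoint interiors
covering `ℝⁿ`, all of whose end points lie in a set `D` of reals any two distinct elements of
which are more than `d > 0` apart (such a `D` is automatically discrete). -/
def IsRegulatedPartitionReal {n : ℕ} (Q : Set (Set (Fin n → ℝ))) : Prop :=
  (∃ (D : Set ℝ) (d : ℝ), 0 < d ∧ (∀ r ∈ D, ∀ s ∈ D, r ≠ s → d < |r - s|) ∧
    ∀ R ∈ Q, ∃ a b : Fin n → ℝ,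
      (∀ i, a i ∈ D ∧ b i ∈ D ∧ a i < b i) ∧ R = Set.Icc a b) ∧
  (∀ x, ∃ R ∈ Q, x ∈ R) ∧
  (∀ R₁ ∈ Q, ∀ R₂ ∈ Q, R₁ ≠ R₂ → interior R₁ ∩ interior R₂ = ∅)

/-- A `γ`-regulated partition of `ℝⁿ`: every point lies in at most `γ` many members. -/
def IsGammaRegulatedReal {n : ℕ} (γ : ℕ) (Q : Set (Set (Fin n → ℝ))) : Prop :=
  IsRegulatedPartitionReal Q ∧ ∀ x, {R ∈ Q | x ∈ R}.encard ≤ γ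

/-! ### Rectangular partitions of `ℤⁿ` -/

/-- An `n`-dimensional rectangle in `ℤⁿ`: a product of integer intervals `[aᵢ, bᵢ]` with
`aᵢ < bᵢ`. -/
def IsRectangle {n : ℕ} (S : Set (Fin n → ℤ)) : Prop :=
  ∃ a b : Fin n → ℤ, (∀ i, a i < b i) ∧ S = Set.Icc a b

/-- The closed unit cube of `ℝⁿ` centered at an integer point. -/
def cube {n : ℕ} (a : Fin n → ℤ) : Set (Fin n → ℝ) :=
  Set.Icc (fun i => (a i : ℝ) - 1 / 2) (fun i => (a i : ℝ) + 1 / 2)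

/-- The union of the unit cubes centered at the points of `S`. -/
def cubes {n : ℕ} (S : Set (Fin n → ℤ)) : Set (Fin n → ℝ) :=
  ⋃ a ∈ S, cube a

/-- A rectangular partition of `ℤⁿ`. -/
def IsRectangularPartition {n : ℕ} (C : Set (Set (Fin n → ℤ))) : Prop :=
  Setoid.IsPartition C ∧ ∀ S ∈ C, IsRectangle S

/-- A `γ`-regulated partition of `ℤⁿ`: a rectangular partition of `ℤⁿ` whose induced partition
of `ℝⁿ` is `γ`-regulated. -/
def IsGammaRegulatedInt {n : ℕ} (γ : ℕ) (C : Set (Set (Fin n → ℤ))) : Prop :=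
  IsRectangularPartition C ∧ IsGammaRegulatedReal γ (cubes '' C)

/-! ### The free part of the Bernoulli shift -/

/-- The Bernoulli shift action of `ℤⁿ` on `2^{ℤⁿ}`. -/
def shift {n : ℕ} (g : Fin n → ℤ) (z : (Fin n → ℤ) → Bool) : (Fin n → ℤ) → Bool :=
  fun h => z (h + g)

/-- The free part `F(2^{ℤⁿ})`, with the topology induced by the product topology on `2^{ℤⁿ}`
(each factor being the discrete two-point space). -/
abbrev FreePart (n : ℕ) : Type :=
  {z : (Fin n → ℤ) → Bool // ∀ g : Fin n → ℤ, g ≠ 0 → shift g z ≠ z}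

theorem shift_shift {n : ℕ} (g k : Fin n → ℤ) (z : (Fin n → ℤ) → Bool) :
    shift g (shift k z) = shift (g + k) z := by
  funext h
  simp only [shift, add_assoc]

/-- The shift action restricted to the free part. -/
def act {n : ℕ} (g : Fin n → ℤ) (z : FreePart n) : FreePart n :=
  ⟨shift g z.1, fun k hk h => z.2 k hk (by
    have h2 := congrArg (shift (-g)) h
    rw [shift_shift, shift_shift, shift_shift] at h2
    have e1 : -g + k + g = k := by abel
    have e2 : -g + g = 0 := by abel
    rw [e1, e2] at h2
    rw [h2]
    funext x
    simp [shift])⟩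

/-- The set `S · z` of all `g · z` with `g ∈ S`. -/
def translate {n : ℕ} (S : Set (Fin n → ℤ)) (z : FreePart n) : Set (FreePart n) :=
  (fun g => act g z) '' S

/-- A regulated partition of `F(2^{ℤⁿ})`: a partition into `n`-dimensional rectangles
`S · z` of orbits. -/
def IsRegulatedPartition {n : ℕ} (P : Set (Set (FreePart n))) : Prop :=
  Setoid.IsPartition P ∧
    ∀ A ∈ P, ∃ (z : FreePart n) (S : Set (Fin n → ℤ)), IsRectangle S ∧ A = translate S z

/-- A partition `P` of `F(2^{ℤⁿ})` is clopen if for every `g` the set of those `u` for which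
`u` and `g · u` lie in the same member of `P` is relatively clopen in `F(2^{ℤⁿ})`. -/
def IsClopenPartition {n : ℕ} (P : Set (Set (FreePart n))) : Prop :=
  ∀ g : Fin n → ℤ, IsClopen {u : FreePart n | ∃ A ∈ P, u ∈ A ∧ act g u ∈ A}

/-- A `γ`-regulated partition of `F(2^{ℤⁿ})`: a regulated partition which induces a
`γ`-regulated partition of `ℤⁿ` at every point. -/
def IsGammaRegulated {n : ℕ} (γ : ℕ) (P : Set (Set (FreePart n))) : Prop :=
  IsRegulatedPartition P ∧
    ∀ z : FreePart n, IsGammaRegulatedInt γ {S : Set (Fin n → ℤ) | translate S z ∈ P}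

end RegPart

/-!
Points of a free orbit at bounded distance receive different colours under a suitable locally
constant colouring. Going through the colours one after another, choose markers which are more
than `N` apart but come within `N` of every point, and around each marker a box of scale `N` whose
faces are at distance at least two from the faces of the earlier boxes nearby. There are boundedly
many of these, so a large `N` leaves enough room, and all choices depend on finitely many colours,
so they are locally constant.

A point belongs to the box of least rank containing it, the rank being the colour of the marker.
What remains of a box `B` is divided into cells by extending the faces of the boxes of lower rank
meeting `B`: throughout `B` in all directions but two directions `i` and `j`, only along the lines
in direction `j` meeting the lower box for the faces orthogonal to `j`, and only across one segment
of such a division for the faces orthogonal to `i`. If the four points of a unit square parallel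
to the `i, j`-plane lay in four cells, both of its columns would be cut by a face of one box, which
owns one of the rows; the cuts of the two rows would then come from a common box of lower rank,
which would have to contain a point of the first row. So the square meets at most three cells, and
the `2 ^ n` points whose unit cubes contain a given point of `ℝⁿ` split into `2 ^ (n - 2)` squares.
-/

namespace RegPart

open scoped Pointwise

/-! ### Greedy choices along a locally constant colouring -/

section LocallyConstant

open Filter Topology

variable {X : Type*} [TopologicalSpace X]

theorem exists_isLocallyConstant_mem {U : ℕ → Set X} (hU : ∀ m, IsClopen (U m))
    (hcover : ∀ x, ∃ m, x ∈ U m) : ∃ c : X → ℕ, IsLocallyConstant c ∧ ∀ x, x ∈ U (c x) := by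
  classical
  refine ⟨fun x => Nat.find (hcover x), ?_, fun x => Nat.find_spec (hcover x)⟩
  rw [IsLocallyConstant.iff_eventually_eq]
  intro x
  have hx : ∀ᶠ y in 𝓝 x, ∀ m ∈ Finset.range (Nat.find (hcover x) + 1), (y ∈ U m ↔ x ∈ U m) := by
    refine (Finset.eventually_all _).2 fun m _ => ?_
    by_cases hm : x ∈ U m
    · exact ((hU m).isOpen.eventually_mem hm).mono fun y hy => iff_of_true hy hm
    · exact ((hU m).compl.isOpen.eventually_mem hm).mono fun y hy => iff_of_false hy hm
  filter_upwards [hx] with y hy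
  refine (Nat.find_eq_iff (hcover y)).2
    ⟨(hy _ (Finset.self_mem_range_succ _)).2 (Nat.find_spec (hcover x)), fun m hm => ?_⟩
  rw [hy m (Finset.mem_range.2 (by omega))]
  exact Nat.find_min (hcover x) hm

variable {κ : Type*} [Finite κ] {φ : κ → X → X}

theorem exists_isClopen_forall_notMem [TotallySeparatedSpace X] (hφ : ∀ i, Continuous (φ i))
    {x : X} (hx : ∀ i, φ i x ≠ x) :
    ∃ U, IsClopen U ∧ x ∈ U ∧ ∀ i, ∀ y ∈ U, φ i y ∉ U := by
  choose V hV hxV hφV using fun i => exists_isClopen_of_totally_separated (hx i).symm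
  refine ⟨⋂ i, V i ∩ φ i ⁻¹' (V i)ᶜ, isClopen_iInter_of_finite fun i =>
    (hV i).inter ((hV i).compl.preimage (hφ i)), Set.mem_iInter.2 fun i => ⟨hxV i, hφV i⟩, ?_⟩
  intro i y hy hφy
  exact (Set.mem_iInter.1 hy i).2 (Set.mem_iInter.1 hφy i).1

theorem exists_isLocallyConstant_ne [TotallySeparatedSpace X] [LindelofSpace X]
    (hφ : ∀ i, Continuous (φ i)) (hfix : ∀ i x, φ i x ≠ x) :
    ∃ c : X → ℕ, IsLocallyConstant c ∧ ∀ i x, c (φ i x) ≠ c x := by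
  choose U hU hxU hφU using fun x => exists_isClopen_forall_notMem hφ fun i => hfix i x
  obtain ⟨t, ht, htU⟩ := LindelofSpace.elim_nhds_subcover U fun x =>
    (hU x).isOpen.mem_nhds (hxU x)
  rcases isEmpty_or_nonempty X with hX | ⟨⟨x₀⟩⟩
  · exact ⟨0, IsLocallyConstant.const 0, fun _ x => isEmptyElim x⟩
  have hcover (x : X) : ∃ y ∈ t, x ∈ U y := by
    simpa only [Set.mem_iUnion₂, exists_prop] using htU.ge (Set.mem_univ x)
  obtain ⟨y₀, hy₀, -⟩ := hcover x₀
  obtain ⟨e, rfl⟩ := ht.exists_eq_range ⟨y₀, hy₀⟩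
  obtain ⟨c, hc, hcU⟩ := exists_isLocallyConstant_mem (fun m => hU (e m))
    fun x => Set.exists_range_iff.1 (hcover x)
  exact ⟨c, hc, fun i x h => hφU _ i x (hcU x) (h ▸ hcU (φ i x))⟩

end LocallyConstant

section Greedy

variable {X κ A : Type*}

/-- The values of `f` at those of the points `φ i x` which have a smaller colour than `x`; the
other values are replaced by `a₀`. -/
def earlierValues (c : X → ℕ) (φ : κ → X → X) (a₀ : A) (f : X → A) (x : X) (i : κ) : A :=
  if c (φ i x) < c x then f (φ i x) else a₀

theorem earlierValues_none_eq_some_iff {c : X → ℕ} {φ : κ → X → X} {f : X → Option A} {x : X}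
    {i : κ} {a : A} :
    earlierValues c φ none f x i = some a ↔ c (φ i x) < c x ∧ f (φ i x) = some a := by
  unfold earlierValues
  split_ifs with h <;> simp [h]

/-- The solution `f` of the recursive equation `f x = Φ (earlierValues c φ a₀ f x)`, defined colour
by colour. -/
def greedy (c : X → ℕ) (φ : κ → X → X) (a₀ : A) (Φ : (κ → A) → A) (x : X) : A :=
  Φ fun i => if _ : c (φ i x) < c x then greedy c φ a₀ Φ (φ i x) else a₀
termination_by c x

theorem greedy_eq (c : X → ℕ) (φ : κ → X → X) (a₀ : A) (Φ : (κ → A) → A) (x : X) :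
    greedy c φ a₀ Φ x = Φ (earlierValues c φ a₀ (greedy c φ a₀ Φ) x) := by
  rw [greedy]
  rfl

open Filter Topology in
theorem isLocallyConstant_greedy [TopologicalSpace X] [Finite κ] {c : X → ℕ}
    (hc : IsLocallyConstant c) {φ : κ → X → X} (hφ : ∀ i, Continuous (φ i)) (a₀ : A)
    (Φ : (κ → A) → A) : IsLocallyConstant (greedy c φ a₀ Φ) := by
  rw [IsLocallyConstant.iff_eventually_eq]
  intro x
  induction hx : c x using Nat.strong_induction_on generalizing x with
  | _ m ih =>
    subst hx
    have hearlier (i : κ) : ∀ᶠ y in 𝓝 x,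
        earlierValues c φ a₀ (greedy c φ a₀ Φ) y i =
          earlierValues c φ a₀ (greedy c φ a₀ Φ) x i := by
      filter_upwards [hc.eventually_eq x, (hc.comp_continuous (hφ i)).eventually_eq x,
        eventually_imp_distrib_left.2 fun hlt : c (φ i x) < c x =>
          ((hφ i).tendsto x).eventually (ih _ hlt (φ i x) rfl)] with y hcy hcφy hy
      simp only [Function.comp_apply] at hcφy
      unfold earlierValues
      rw [hcy, hcφy]
      split_ifs with hlt
      · exact hy hlt
      · rfl
    filter_upwards [eventually_all.2 hearlier] with y hy
    rw [greedy_eq, greedy_eq, funext hy]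

end Greedy

/-! ### Boxes in `ℤ^ι` -/

/-- The half-open box `∏ₖ [lo k, hi k)` in `ℤ^ι`. -/
@[ext] structure IntBox (ι : Type*) where
  lo : ι → ℤ
  hi : ι → ℤ

namespace IntBox

variable {ι : Type*} {E E' : IntBox ι} {p q : ι → ℤ} {k : ι}

/-- The `k`-th side of a box. -/
def side (E : IntBox ι) (k : ι) : Set ℤ := Set.Ico (E.lo k) (E.hi k)

/-- The positions of the two faces of a box orthogonal to the `k`-th axis. The upper position
`hi k` is the first integer beyond the side. -/
def faces (E : IntBox ι) (k : ι) : Set ℤ := {E.lo k, E.hi k}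

/-- The points of a box. -/
def toSet (E : IntBox ι) : Set (ι → ℤ) := {p | ∀ k, p k ∈ E.side k}

/-- Two boxes in general position: their parallel faces are at distance at least two. -/
def FacesApart (E E' : IntBox ι) : Prop :=
  ∀ k, ∀ x ∈ E.faces k, ∀ y ∈ E'.faces k, 2 ≤ |x - y|

/-- The lower corner of the box is within sup-distance `r` of `p`. -/
def Near (r : ℤ) (E : IntBox ι) (p : ι → ℤ) : Prop := ∀ k, |E.lo k - p k| ≤ r

theorem mem_side {x : ℤ} : x ∈ E.side k ↔ E.lo k ≤ x ∧ x < E.hi k := Iff.rfl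

theorem mem_faces {x : ℤ} : x ∈ E.faces k ↔ x = E.lo k ∨ x = E.hi k := Iff.rfl

theorem mem_toSet : p ∈ E.toSet ↔ ∀ k, p k ∈ E.side k := Iff.rfl

theorem lo_mem_faces (E : IntBox ι) (k : ι) : E.lo k ∈ E.faces k := Or.inl rfl

theorem hi_mem_faces (E : IntBox ι) (k : ι) : E.hi k ∈ E.faces k := Or.inr rfl

theorem Near.mono {r s : ℤ} (h : E.Near r p) (hrs : r ≤ s) : E.Near s p :=
  fun k => (h k).trans hrs

theorem near_of_mem {D : ℤ} (hE : ∀ k, E.hi k ≤ E.lo k + D) (hp : p ∈ E.toSet) : E.Near D p := by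
  intro k
  have hpk := mem_side.1 (hp k)
  have := hE k
  rw [abs_le]
  omega

theorem Near.of_mem {r D : ℤ} (h : E.Near r p) (hE : ∀ k, E.hi k ≤ E.lo k + D)
    (hE' : ∀ k, E'.hi k ≤ E'.lo k + D) (hq : q ∈ E.toSet) (hq' : q ∈ E'.toSet) :
    E'.Near (r + D) p := by
  intro k
  have hqk := mem_side.1 (hq k)
  have hqk' := mem_side.1 (hq' k)
  have := hE k
  have := hE' k
  have hk := h k
  rw [abs_le] at hk ⊢
  omega

theorem toSet_eq_Icc (E : IntBox ι) : E.toSet = Set.Icc E.lo (fun k => E.hi k - 1) := by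
  ext p
  simp only [mem_toSet, mem_side, Set.mem_Icc, Pi.le_def, ← forall_and, Int.le_sub_one_iff]

instance : AddAction (ι → ℤ) (IntBox ι) where
  vadd g E := ⟨g + E.lo, g + E.hi⟩
  zero_vadd _ := IntBox.ext (zero_add _) (zero_add _)
  add_vadd _ _ _ := IntBox.ext (add_assoc _ _ _) (add_assoc _ _ _)

variable {g : ι → ℤ}

theorem vadd_lo (g : ι → ℤ) (E : IntBox ι) : (g +ᵥ E).lo = g + E.lo := rfl

theorem vadd_hi (g : ι → ℤ) (E : IntBox ι) : (g +ᵥ E).hi = g + E.hi := rfl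

theorem add_mem_side_vadd {x : ℤ} : g k + x ∈ (g +ᵥ E).side k ↔ x ∈ E.side k := by
  simp only [mem_side, vadd_lo, vadd_hi, Pi.add_apply, add_le_add_iff_left, add_lt_add_iff_left]

theorem add_mem_faces_vadd {x : ℤ} : g k + x ∈ (g +ᵥ E).faces k ↔ x ∈ E.faces k := by
  simp only [mem_faces, vadd_lo, vadd_hi, Pi.add_apply, add_right_inj]

theorem add_mem_toSet_vadd : g + p ∈ (g +ᵥ E).toSet ↔ p ∈ E.toSet :=
  forall_congr' fun _ => add_mem_side_vadd

end IntBox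

/-- The point `q` follows `p` in the direction of the `k`-th axis. -/
structure IsStep {ι : Type*} (k : ι) (p q : ι → ℤ) : Prop where
  eq_add_one : q k = p k + 1
  eq_of_ne : ∀ m, m ≠ k → q m = p m

namespace IsStep

variable {ι : Type*} {k : ι} {p q : ι → ℤ} {E : IntBox ι}

theorem abs_sub_le_one (h : IsStep k p q) (m : ι) : |q m - p m| ≤ 1 := by
  by_cases hm : m = k
  · simp only [hm, h.eq_add_one, add_sub_cancel_left, abs_one, le_refl]
  · simp only [h.eq_of_ne m hm, sub_self, abs_zero, zero_le_one]

theorem near_right (h : IsStep k p q) {r : ℤ} (hE : E.Near r p) : E.Near (r + 1) q :=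
  fun m => (abs_sub_le _ (p m) _).trans (add_le_add (hE m) (abs_sub_comm (q m) _ ▸
    h.abs_sub_le_one m))

theorem near_left (h : IsStep k p q) {r : ℤ} (hE : E.Near r q) : E.Near (r + 1) p :=
  fun m => (abs_sub_le _ (q m) _).trans (add_le_add (hE m) (h.abs_sub_le_one m))

theorem mem_left_iff (h : IsStep k p q) :
    p ∈ E.toSet ↔ p k ∈ E.side k ∧ ∀ m, m ≠ k → q m ∈ E.side m := by
  refine ⟨fun hp => ⟨hp k, fun m hm => h.eq_of_ne m hm ▸ hp m⟩, fun hp m => ?_⟩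
  by_cases hm : m = k
  · exact hm ▸ hp.1
  · exact h.eq_of_ne m hm ▸ hp.2 m hm

theorem mem_right_iff (h : IsStep k p q) :
    q ∈ E.toSet ↔ q k ∈ E.side k ∧ ∀ m, m ≠ k → p m ∈ E.side m := by
  refine ⟨fun hq => ⟨hq k, fun m hm => (h.eq_of_ne m hm).symm ▸ hq m⟩, fun hq m => ?_⟩
  by_cases hm : m = k
  · exact hm ▸ hq.1
  · exact (h.eq_of_ne m hm).symm ▸ hq.2 m hm

theorem mem_iff_mem_of_notMem_faces (h : IsStep k p q) (hq : q k ∉ E.faces k) :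
    p ∈ E.toSet ↔ q ∈ E.toSet := by
  have hk : p k ∈ E.side k ↔ q k ∈ E.side k := by
    have := h.eq_add_one
    simp only [IntBox.mem_faces, IntBox.mem_side] at hq ⊢
    omega
  refine forall_congr' fun m => ?_
  by_cases hm : m = k
  · exact hm ▸ hk
  · rw [h.eq_of_ne m hm]

theorem mem_or_mem_of_mem_faces (h : IsStep k p q) (hk : E.lo k < E.hi k)
    (hq : q k ∈ E.faces k) (hp : ∀ m, m ≠ k → p m ∈ E.side m) :
    p ∈ E.toSet ∨ q ∈ E.toSet := by
  rw [h.mem_right_iff, h.mem_left_iff]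
  have := h.eq_add_one
  have hqm : ∀ m, m ≠ k → q m ∈ E.side m := fun m hm => (h.eq_of_ne m hm).symm ▸ hp m hm
  simp only [IntBox.mem_faces, IntBox.mem_side] at hq ⊢
  rcases hq with hq | hq
  · exact Or.inr ⟨by omega, hp⟩
  · exact Or.inl ⟨by omega, hqm⟩

theorem not_mem_left_and_mem_right (h : IsStep k p q) (hq : q k ∈ E.faces k) :
    ¬ (p ∈ E.toSet ∧ q ∈ E.toSet) := by
  rintro ⟨hp, hq'⟩
  have hpk := IntBox.mem_side.1 (hp k)
  have hqk := IntBox.mem_side.1 (hq' k)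
  have := h.eq_add_one
  rw [IntBox.mem_faces] at hq
  omega

end IsStep

/-- `[a, b)` is the interval between two consecutive elements of `S` which contains `x`. -/
structure IsGap (S : Set ℤ) (x a b : ℤ) : Prop where
  left_mem : a ∈ S
  right_mem : b ∈ S
  mem_Ico : x ∈ Set.Ico a b
  notMem_Ioo : ∀ y ∈ S, y ∉ Set.Ioo a b

namespace IsGap

variable {S : Set ℤ} {x a b : ℤ}

theorem le_iff {y t : ℤ} (h : IsGap S x a b) (hy : y ∈ S) (ht : t ∈ Set.Ico a b) :
    y ≤ t ↔ y ≤ x := by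
  have := h.notMem_Ioo y hy
  have := h.mem_Ico
  simp only [Set.mem_Ioo, Set.mem_Ico] at *
  omega

theorem unique {a' b' : ℤ} (h : IsGap S x a b) (h' : IsGap S x a' b') : a = a' ∧ b = b' := by
  have := h.notMem_Ioo _ h'.left_mem
  have := h.notMem_Ioo _ h'.right_mem
  have := h'.notMem_Ioo _ h.left_mem
  have := h'.notMem_Ioo _ h.right_mem
  have := h.mem_Ico
  have := h'.mem_Ico
  simp only [Set.mem_Ioo, Set.mem_Ico] at *
  omega

theorem exists_of_mem_Ico (ha : a ∈ S) (hb : b ∈ S) (hx : x ∈ Set.Ico a b) :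
    ∃ a b, IsGap S x a b := by
  obtain ⟨l, ⟨hl, hlx⟩, hl'⟩ := Int.exists_greatest_of_bdd (P := fun y => y ∈ S ∧ y ≤ x)
    ⟨x, fun z hz => hz.2⟩ ⟨a, ha, hx.1⟩
  obtain ⟨u, ⟨hu, hux⟩, hu'⟩ := Int.exists_least_of_bdd (P := fun y => y ∈ S ∧ x < y)
    ⟨x, fun z hz => hz.2.le⟩ ⟨b, hb, hx.2⟩
  refine ⟨l, u, hl, hu, ⟨hlx, hux⟩, fun y hy h => ?_⟩
  rcases le_or_gt y x with hyx | hxy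
  · exact (hl' y ⟨hy, hyx⟩).not_gt h.1
  · exact (hu' y ⟨hy, hxy⟩).not_gt h.2

theorem add_left {S' : Set ℤ} {t : ℤ} (h : IsGap S x a b) (hS : ∀ y, t + y ∈ S' ↔ y ∈ S) :
    IsGap S' (t + x) (t + a) (t + b) where
  left_mem := (hS a).2 h.left_mem
  right_mem := (hS b).2 h.right_mem
  mem_Ico := ⟨by linarith [h.mem_Ico.1], by linarith [h.mem_Ico.2]⟩
  notMem_Ioo y hy hyab := by
    refine h.notMem_Ioo (y - t) ((hS _).1 (by rwa [add_sub_cancel])) ?_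
    exact ⟨by linarith [hyab.1], by linarith [hyab.2]⟩

end IsGap

/-! ### Markers -/

section Ball

variable {ι : Type*} {r s : ℤ} {g : ι → ℤ}

/-- The cube `[-r, r]^ι` of integer points. -/
def ball (ι : Type*) (r : ℤ) : Set (ι → ℤ) := {g | ∀ k, |g k| ≤ r}

theorem mem_ball : g ∈ ball ι r ↔ ∀ k, |g k| ≤ r := Iff.rfl

theorem neg_mem_ball : -g ∈ ball ι r ↔ g ∈ ball ι r := by
  simp only [mem_ball, Pi.neg_apply, abs_neg]

theorem zero_mem_ball (hr : 0 ≤ r) : 0 ∈ ball ι r :=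
  mem_ball.2 fun _ => by rwa [Pi.zero_apply, abs_zero]

theorem ball_subset_ball (hrs : r ≤ s) : ball ι r ⊆ ball ι s :=
  fun _ hg k => (hg k).trans hrs

theorem finite_ball [Finite ι] (r : ℤ) : (ball ι r).Finite := by
  refine (Set.Finite.pi' fun _ => Set.finite_Icc (-r) r).subset fun g hg k => ?_
  exact abs_le.1 (hg k)

instance [Finite ι] : Finite ↥(ball ι r \ {0}) :=
  (finite_ball r).sdiff.to_subtype

theorem card_le_of_separated [Fintype ι] {κ : Type*} [Fintype κ] {N ρ : ℕ} (hN : 0 < N)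
    (m : κ → ι → ℤ) (hm : ∀ a, m a ∈ ball ι (ρ * N))
    (hsep : ∀ a b, a ≠ b → m a - m b ∉ ball ι N) :
    Fintype.card κ ≤ (2 * ρ + 1) ^ Fintype.card ι := by
  classical
  have hN' : (0 : ℤ) < N := by exact_mod_cast hN
  let grid : Finset (ι → ℤ) := Fintype.piFinset fun _ => Finset.Icc (-ρ : ℤ) ρ
  have hgrid : grid.card = (2 * ρ + 1) ^ Fintype.card ι := by
    simp only [grid, Fintype.card_piFinset, Int.card_Icc, Finset.prod_const, Finset.card_univ]
    congr 1
    omega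
  rw [← hgrid, ← Finset.card_univ]
  refine Finset.card_le_card_of_injOn (fun a k => m a k / N) (fun a _ => ?_) fun a _ b _ hab => ?_
  · refine Fintype.mem_piFinset.2 fun k => Finset.mem_Icc.2 ?_
    have hmk := abs_le.1 (hm a k)
    refine ⟨(Int.le_ediv_iff_mul_le hN').2 (by linarith), ?_⟩
    have := Int.ediv_le_ediv hN' hmk.2
    rwa [Int.mul_ediv_cancel _ hN'.ne'] at this
  · by_contra hne
    refine hsep a b hne fun k => ?_
    have hdiv : m a k / N = m b k / N := congrFun hab k
    have ha := Int.emod_add_mul_ediv (m a k) N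
    have hb := Int.emod_add_mul_ediv (m b k) N
    have := Int.emod_lt_of_pos (m a k) hN'
    have := Int.emod_lt_of_pos (m b k) hN'
    have := Int.emod_nonneg (m a k) hN'.ne'
    have := Int.emod_nonneg (m b k) hN'.ne'
    rw [hdiv] at ha
    rw [Pi.sub_apply, abs_le]
    omega

end Ball

theorem exists_mem_Icc_two_le_abs_sub {N : ℕ} (F : Finset ℤ) (hF : 3 * F.card ≤ N) (s : ℤ) :
    ∃ x ∈ Set.Icc s (s + N), ∀ y ∈ F, 2 ≤ |x - y| := by
  let bad : Finset ℤ := F.biUnion fun y => {y - 1, y, y + 1}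
  have hbad : bad.card < (Finset.Icc s (s + N)).card := by
    have : bad.card ≤ F.card * 3 :=
      Finset.card_biUnion_le_card_mul _ _ 3 fun y _ => Finset.card_le_three
    rw [Int.card_Icc]
    omega
  obtain ⟨x, hx, hxbad⟩ := Finset.exists_mem_notMem_of_card_lt_card hbad
  refine ⟨x, Finset.mem_Icc.1 hx, fun y hy => ?_⟩
  simp only [bad, Finset.mem_biUnion, not_exists, not_and, Finset.mem_insert,
    Finset.mem_singleton] at hxbad
  have := hxbad y hy
  rw [le_abs]
  omega

namespace IntBox

variable {ι : Type*} {E E' : IntBox ι}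

/-- The box contains the cube `[-N, N]^ι` and is contained in `[-2N, 2N]^ι`. -/
def Surrounds (N : ℕ) (E : IntBox ι) : Prop :=
  ∀ k, -(2 * N : ℤ) ≤ E.lo k ∧ E.lo k ≤ -N ∧ (N : ℤ) < E.hi k ∧ E.hi k ≤ 2 * N + 1

theorem FacesApart.symm (h : E.FacesApart E') : E'.FacesApart E :=
  fun k x hx y hy => abs_sub_comm y x ▸ h k y hy x hx

theorem FacesApart.vadd (g : ι → ℤ) (h : E.FacesApart E') :
    (g +ᵥ E).FacesApart (g +ᵥ E') := by
  intro k x hx y hy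
  have := h k (x - g k) (add_mem_faces_vadd.1 (by rwa [add_sub_cancel])) (y - g k)
    (add_mem_faces_vadd.1 (by rwa [add_sub_cancel]))
  rwa [sub_sub_sub_cancel_right] at this

theorem exists_surrounds_facesApart {κ : Type*} [Fintype κ] {N : ℕ} (F : κ → IntBox ι)
    (hN : 6 * Fintype.card κ ≤ N) :
    ∃ E : IntBox ι, E.Surrounds N ∧ ∀ a, E.FacesApart (F a) := by
  classical
  let coords (k : ι) : Finset ℤ := Finset.univ.biUnion fun a => {(F a).lo k, (F a).hi k}
  have hcoords (k : ι) : 3 * (coords k).card ≤ N := by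
    have : (coords k).card ≤ Fintype.card κ * 2 :=
      Finset.card_biUnion_le_card_mul _ _ 2 fun a _ => Finset.card_le_two
    omega
  have hmem (a : κ) (k : ι) (y : ℤ) (hy : y ∈ (F a).faces k) : y ∈ coords k :=
    Finset.mem_biUnion.2 ⟨a, Finset.mem_univ a, by simpa [mem_faces] using hy⟩
  choose lo hlo hlo' using fun k =>
    exists_mem_Icc_two_le_abs_sub (coords k) (hcoords k) (-(2 * N : ℤ))
  choose hi hhi hhi' using fun k =>
    exists_mem_Icc_two_le_abs_sub (coords k) (hcoords k) ((N : ℤ) + 1)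
  refine ⟨⟨lo, hi⟩, fun k => ?_, fun a k x hx y hy => ?_⟩
  · have := Set.mem_Icc.1 (hlo k)
    have := Set.mem_Icc.1 (hhi k)
    dsimp only
    omega
  · rcases hx with rfl | rfl
    · exact hlo' k y (hmem a k y hy)
    · exact hhi' k y (hmem a k y hy)

end IntBox

section Marking

variable {ι : Type*} {N : ℕ} {r : ℤ}

/-- The box `E` is in general position with respect to all boxes `d g`, moved to `g`. -/
def IsGoodPosition (N : ℕ) {G : Set (ι → ℤ)} (d : G → Option (IntBox ι)) (E : IntBox ι) : Prop :=
  E.Surrounds N ∧ ∀ (g : G) (E' : IntBox ι), d g = some E' → E.FacesApart ((g : ι → ℤ) +ᵥ E')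

theorem exists_isGoodPosition [Fintype ι] {ρ : ℕ} (hN : 6 * (2 * ρ + 1) ^ Fintype.card ι < N)
    {G : Set (ι → ℤ)} (hG : G ⊆ ball ι (ρ * N)) (d : G → Option (IntBox ι))
    (hd : ∀ g h : G, (d g).isSome → (d h).isSome → g ≠ h → (g - h : ι → ℤ) ∉ ball ι N) :
    ∃ E, IsGoodPosition N d E := by
  classical
  have : Finite G := (finite_ball _).subset hG
  let _ : Fintype {g : G // (d g).isSome} := Fintype.ofFinite _
  have hcard : Fintype.card {g : G // (d g).isSome} ≤ (2 * ρ + 1) ^ Fintype.card ι :=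
    card_le_of_separated (by omega) (fun a => (a : ι → ℤ)) (fun a => hG a.1.2)
      fun a b hab => hd a b a.2 b.2 (Subtype.coe_injective.ne hab)
  obtain ⟨E, hE, hEF⟩ := IntBox.exists_surrounds_facesApart (N := N)
    (fun a : {g : G // (d g).isSome} => (a : ι → ℤ) +ᵥ (d a).get a.2) (by omega)
  refine ⟨E, hE, fun g E' hg => ?_⟩
  have := hEF ⟨g, hg ▸ rfl⟩
  simpa only [hg, Option.get_some] using this

open Classical in
/-- The greedy choice of a box at the origin, given the boxes `d g` already chosen at the points
`g`: there is none if a box has been chosen at distance at most `N`. -/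
noncomputable def markerRule (N : ℕ) {G : Set (ι → ℤ)} (d : G → Option (IntBox ι)) :
    Option (IntBox ι) :=
  if h : (∃ E, IsGoodPosition N d E) ∧ ∀ g : G, (g : ι → ℤ) ∈ ball ι N → d g = none
  then some h.1.choose else none

theorem markerRule_eq_some {G : Set (ι → ℤ)} {d : G → Option (IntBox ι)} {E : IntBox ι}
    (h : markerRule N d = some E) :
    IsGoodPosition N d E ∧ ∀ g : G, (g : ι → ℤ) ∈ ball ι N → d g = none := by
  unfold markerRule at h
  split_ifs at h with hd
  exact Option.some_inj.1 h ▸ ⟨hd.1.choose_spec, hd.2⟩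

theorem exists_markerRule_eq_some {G : Set (ι → ℤ)} {d : G → Option (IntBox ι)}
    (h : ∃ E, IsGoodPosition N d E) (hd : ∀ g : G, (g : ι → ℤ) ∈ ball ι N → d g = none) :
    ∃ E, markerRule N d = some E :=
  ⟨_, dif_pos ⟨h, hd⟩⟩

variable {X : Type*} [AddAction (ι → ℤ) X] {c : X → ℕ} {x : X} {g : ι → ℤ}

/-- The colouring `c` separates any two distinct points of an orbit at distance at most `r`. -/
def IsProperColoring (ι : Type*) {X : Type*} [AddAction (ι → ℤ) X] (r : ℤ) (c : X → ℕ) : Prop :=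
  ∀ x : X, ∀ g ∈ ball ι r, g ≠ 0 → c (g +ᵥ x) ≠ c x

/-- The boxes chosen greedily, colour by colour. The point `x` is a marker if
`markerBox N r c x` is not `none`, which then is a box relative to `x`. -/
noncomputable def markerBox (N : ℕ) (r : ℤ) (c : X → ℕ) : X → Option (IntBox ι) :=
  greedy c (fun (g : ↥(ball ι r \ {0})) x => (g : ι → ℤ) +ᵥ x) none (markerRule N)

theorem markerBox_eq (x : X) : markerBox N r c x =
    markerRule N (earlierValues c (fun (g : ↥(ball ι r \ {0})) x => (g : ι → ℤ) +ᵥ x) none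
      (markerBox N r c) x) :=
  greedy_eq _ _ _ _ _

theorem surrounds_of_markerBox_eq_some {E : IntBox ι} (h : markerBox N r c x = some E) :
    E.Surrounds N := by
  rw [markerBox_eq] at h
  exact (markerRule_eq_some h).1.1

theorem facesApart_and_notMem_ball {E E' : IntBox ι} (hc : IsProperColoring ι r c)
    (hg : g ∈ ball ι r) (hg0 : g ≠ 0) (h : markerBox N r c x = some E)
    (h' : markerBox N r c (g +ᵥ x) = some E') : E.FacesApart (g +ᵥ E') ∧ g ∉ ball ι N := by
  wlog hlt : c (g +ᵥ x) < c x generalizing x g E E'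
  · have hlt' : c x < c (g +ᵥ x) := (hc x g hg hg0).lt_of_le' (not_lt.1 hlt)
    obtain ⟨hE, hgN⟩ := this (neg_mem_ball.2 hg) (neg_ne_zero.2 hg0) h'
      (by rwa [neg_vadd_vadd]) (by rwa [neg_vadd_vadd])
    have := hE.symm.vadd g
    rw [vadd_neg_vadd] at this
    exact ⟨this, mt neg_mem_ball.2 hgN⟩
  rw [markerBox_eq] at h
  obtain ⟨hE, hnone⟩ := markerRule_eq_some h
  let g' : ↥(ball ι r \ {0}) := ⟨g, hg, hg0⟩
  have hd := (earlierValues_none_eq_some_iff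
    (φ := fun (g : ↥(ball ι r \ {0})) x => (g : ι → ℤ) +ᵥ x) (i := g')).2 ⟨hlt, h'⟩
  exact ⟨hE.2 g' E' hd, fun hgN => Option.some_ne_none _ (hd.symm.trans (hnone g' hgN))⟩

theorem exists_markerBox_eq_some [Fintype ι] {ρ : ℕ} (hρ : 1 ≤ ρ)
    (hN : 6 * (2 * ρ + 1) ^ Fintype.card ι < N) (hc : IsProperColoring ι (ρ * N) c) (x : X) :
    ∃ g ∈ ball ι N, ∃ E : IntBox ι, markerBox N (ρ * N) c (g +ᵥ x) = some E := by
  by_contra! hnone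
  have hsub : ball ι N ⊆ ball ι (ρ * N) := ball_subset_ball (by nlinarith)
  let d : ↥(ball ι (ρ * N) \ {0}) → Option (IntBox ι) :=
    earlierValues c (fun g x => (g : ι → ℤ) +ᵥ x) none (markerBox N (ρ * N) c) x
  have hsep (g h : ↥(ball ι (ρ * N) \ {0})) (hg : (d g).isSome) (hh : (d h).isSome)
      (hne : g ≠ h) : (g - h : ι → ℤ) ∉ ball ι N := by
    intro hgh
    obtain ⟨E, hE⟩ := Option.isSome_iff_exists.1 hg
    obtain ⟨E', hE'⟩ := Option.isSome_iff_exists.1 hh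
    rw [earlierValues_none_eq_some_iff] at hE hE'
    refine (facesApart_and_notMem_ball (E' := E) hc (hsub hgh)
      (sub_ne_zero.2 (Subtype.coe_injective.ne hne)) hE'.2 ?_).2 hgh
    rw [vadd_vadd, sub_add_cancel]
    exact hE.2
  have hd (g : ↥(ball ι (ρ * N) \ {0})) (hg : (g : ι → ℤ) ∈ ball ι N) : d g = none :=
    Option.eq_none_iff_forall_ne_some.2 fun E hE =>
      hnone g hg E (earlierValues_none_eq_some_iff.1 hE).2
  obtain ⟨E, hE⟩ := exists_markerRule_eq_some
    (exists_isGoodPosition hN Set.sdiff_subset d hsep) hd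
  rw [← markerBox_eq, ← zero_vadd (ι → ℤ) x] at hE
  exact hnone 0 (zero_mem_ball (by omega)) E hE

/-- A locally constant choice of markers, at each of which there is a box of scale `N`. There is
a marker near every point, and the boxes at any two markers at distance at most `r` are in
general position and have different colours. -/
structure IsMarking [TopologicalSpace X] (N : ℕ) (r : ℤ) (c : X → ℕ) (f : X → Option (IntBox ι)) :
    Prop where
  isLocallyConstant_color : IsLocallyConstant c
  isLocallyConstant : IsLocallyConstant f
  isProperColoring : IsProperColoring ι r c
  surrounds : ∀ x E, f x = some E → E.Surrounds N
  syndetic : ∀ x, ∃ g ∈ ball ι N, ∃ E, f (g +ᵥ x) = some E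
  facesApart : ∀ x, ∀ g ∈ ball ι r, g ≠ 0 → ∀ E E', f x = some E → f (g +ᵥ x) = some E' →
    E.FacesApart (g +ᵥ E')

variable [TopologicalSpace X] [ContinuousConstVAdd (ι → ℤ) X]

theorem exists_isProperColoring [Finite ι] [TotallySeparatedSpace X] [LindelofSpace X]
    [IsCancelVAdd (ι → ℤ) X] (r : ℤ) :
    ∃ c : X → ℕ, IsLocallyConstant c ∧ IsProperColoring ι r c := by
  obtain ⟨c, hc, hne⟩ := exists_isLocallyConstant_ne
    (φ := fun (g : ↥(ball ι r \ {0})) (x : X) => (g : ι → ℤ) +ᵥ x)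
    (fun g => continuous_const_vadd _) fun g x h => g.2.2 (IsCancelVAdd.eq_zero_of_vadd h)
  exact ⟨c, hc, fun x g hg hg0 => hne ⟨g, hg, hg0⟩ x⟩

theorem exists_isMarking [Finite ι] [TotallySeparatedSpace X] [LindelofSpace X]
    [IsCancelVAdd (ι → ℤ) X] {ρ : ℕ} (hρ : 1 ≤ ρ) :
    ∃ (N : ℕ) (c : X → ℕ) (f : X → Option (IntBox ι)), 1 ≤ N ∧ IsMarking N (ρ * N) c f := by
  cases nonempty_fintype ι
  let N := 6 * (2 * ρ + 1) ^ Fintype.card ι + 1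
  obtain ⟨c, hc, hproper⟩ := exists_isProperColoring (X := X) (ι := ι) (ρ * N)
  refine ⟨N, c, markerBox N (ρ * N) c, by omega, hc, isLocallyConstant_greedy hc
    (fun g => continuous_const_vadd _) _ _, hproper, fun x E => surrounds_of_markerBox_eq_some,
    exists_markerBox_eq_some hρ (Nat.lt_succ_self _) hproper,
    fun x g hg hg0 E E' h h' => (facesApart_and_notMem_ball hproper hg hg0 h h').1⟩

end Marking

/-! ### The cells of a family of ranked boxes -/

/-- A box with a rank. Where several boxes overlap, the one of least rank prevails. -/
structure RankedBox (ι : Type*) extends IntBox ι where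
  rank : ℕ

instance RankedBox.instAddAction {ι : Type*} : AddAction (ι → ℤ) (RankedBox ι) where
  vadd g C := ⟨g +ᵥ C.toIntBox, C.rank⟩
  zero_vadd C := congrArg (RankedBox.mk · C.rank) (zero_vadd _ C.toIntBox)
  add_vadd g h C := congrArg (RankedBox.mk · C.rank) (add_vadd g h C.toIntBox)

theorem RankedBox.vadd_toIntBox {ι : Type*} (g : ι → ℤ) (C : RankedBox ι) :
    (g +ᵥ C).toIntBox = g +ᵥ C.toIntBox := rfl

theorem RankedBox.vadd_rank {ι : Type*} (g : ι → ℤ) (C : RankedBox ι) :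
    (g +ᵥ C).rank = C.rank := rfl

section Cells

variable {ι : Type*} {i j k : ι} {T T' : Set (RankedBox ι)} {D : ℤ} {p q : ι → ℤ}

/-- A cover of `ℤ^ι` by ranked boxes with sides between `2` and `D`, any two nearby ones of
which have different ranks and are in general position. -/
structure Admissible (T : Set (RankedBox ι)) (D : ℤ) : Prop where
  two_le : 2 ≤ D
  cover : ∀ p, ∃ C ∈ T, p ∈ C.toSet
  add_two_le : ∀ C ∈ T, ∀ k, C.lo k + 2 ≤ C.hi k
  le_add : ∀ C ∈ T, ∀ k, C.hi k ≤ C.lo k + D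
  generic : ∀ C ∈ T, ∀ C' ∈ T, C ≠ C' → C.Near (8 * D) C'.lo →
    C.rank ≠ C'.rank ∧ C.FacesApart C'.toIntBox

/-- `B` is the box of least rank containing `p`. -/
structure IsOwner (T : Set (RankedBox ι)) (p : ι → ℤ) (B : RankedBox ι) : Prop where
  mem : B ∈ T
  mem_toSet : p ∈ B.toSet
  rank_le : ∀ C ∈ T, p ∈ C.toSet → B.rank ≤ C.rank

/-- The relation `C` cuts `B` orthogonally to the `k`-th axis near `p`, where `[l, u)` is the
maximal segment through `p` in direction `j` in the subdivision of `B`: besides `B` itself these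
are the boxes of lower rank meeting `B` which, for `k = j`, meet the line through `p` in direction
`j` and, for `k = i`, touch the strip spanned by the segment and direction `i`. -/
def Cuts (i j : ι) (B : RankedBox ι) (p : ι → ℤ) (l u : ℤ) (k : ι) (C : RankedBox ι) : Prop :=
  C = B ∨ (C.rank < B.rank ∧ (C.toSet ∩ B.toSet).Nonempty ∧
    (k = j → ∀ m, m ≠ j → p m ∈ C.side m) ∧
    (k = i → (∀ m, m ≠ i → m ≠ j → p m ∈ C.side m) ∧ C.lo j ≤ u ∧ l ≤ C.hi j))

/-- The positions of the cuts of `B` orthogonal to the `k`-th axis. -/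
def cutSet (i j : ι) (T : Set (RankedBox ι)) (B : RankedBox ι) (p : ι → ℤ) (l u : ℤ) (k : ι) :
    Set ℤ :=
  {x | ∃ C ∈ T, Cuts i j B p l u k C ∧ x ∈ C.faces k}

/-- `E` is the cell of `p` in the subdivision of the owner `B` of `p`: each side of `E` lies
between two consecutive cuts of `B`. -/
structure IsCellOf (i j : ι) (T : Set (RankedBox ι)) (B : RankedBox ι) (p : ι → ℤ)
    (E : IntBox ι) : Prop where
  isOwner : IsOwner T p B
  isGap : ∀ k, IsGap (cutSet i j T B p (E.lo j) (E.hi j) k) (p k) (E.lo k) (E.hi k)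

/-- `E` is the cell of `p`. -/
def IsCell (i j : ι) (T : Set (RankedBox ι)) (p : ι → ℤ) (E : IntBox ι) : Prop :=
  ∃ B, IsCellOf i j T B p E

theorem IsOwner.near {B : RankedBox ι} (hT : Admissible T D) (h : IsOwner T p B) : B.Near D p :=
  IntBox.near_of_mem (hT.le_add B h.mem) h.mem_toSet

namespace Admissible

theorem near_of_inter_nonempty {r : ℤ} {B C : RankedBox ι} (hT : Admissible T D) (hB : B ∈ T)
    (hC : C ∈ T) (h : (C.toSet ∩ B.toSet).Nonempty) (hr : B.Near r p) : C.Near (r + D) p :=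
  hr.of_mem (hT.le_add B hB) (hT.le_add C hC) h.some_mem.2 h.some_mem.1

theorem generic_of_near {C C' : RankedBox ι} (hT : Admissible T D) (hC : C ∈ T) (hC' : C' ∈ T)
    (h : C.Near (4 * D) p) (h' : C'.Near (4 * D) p) (hne : C ≠ C') :
    C.rank ≠ C'.rank ∧ C.FacesApart C'.toIntBox := by
  refine hT.generic C hC C' hC' hne fun k => ?_
  have hk := h k
  have hk' := h' k
  rw [abs_le] at hk hk' ⊢
  omega

theorem eq_of_mem_faces {C C' : RankedBox ι} (hT : Admissible T D) (hC : C ∈ T) (hC' : C' ∈ T)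
    (h : C.Near (4 * D) p) (h' : C'.Near (4 * D) p) {x : ℤ} (hx : x ∈ C.faces k)
    (hx' : x ∈ C'.faces k) : C = C' := by
  by_contra hne
  have := (hT.generic_of_near hC hC' h h' hne).2 k x hx x hx'
  rw [sub_self, abs_zero] at this
  omega

theorem exists_isOwner (hT : Admissible T D) (p : ι → ℤ) : ∃ B, IsOwner T p B := by
  let S : Set (RankedBox ι) := {C | C ∈ T ∧ p ∈ C.toSet}
  have hS : S.Nonempty := hT.cover p
  exact ⟨Function.argminOn RankedBox.rank S hS, (Function.argminOn_mem RankedBox.rank S hS).1,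
    (Function.argminOn_mem RankedBox.rank S hS).2,
    fun C hC hp => Function.argminOn_le RankedBox.rank S (a := C) ⟨hC, hp⟩⟩

theorem eq_of_rank_le {B C : RankedBox ι} (hT : Admissible T D) (hB : IsOwner T p B) (hC : C ∈ T)
    (hp : p ∈ C.toSet) (h : C.rank ≤ B.rank) : C = B := by
  have := hT.two_le
  by_contra hne
  exact (hT.generic_of_near hC hB.mem
    ((IntBox.near_of_mem (hT.le_add C hC) hp).mono (by omega))
    ((hB.near hT).mono (by omega)) hne).1 (h.antisymm (hB.rank_le C hC hp))

theorem isOwner_unique {B B' : RankedBox ι} (hT : Admissible T D) (hB : IsOwner T p B)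
    (hB' : IsOwner T p B') : B = B' :=
  hT.eq_of_rank_le hB' hB.mem hB.mem_toSet (hB.rank_le B' hB'.mem hB'.mem_toSet)

theorem mem_faces_or_of_isOwner_ne (hT : Admissible T D) {B B' : RankedBox ι}
    (hpq : IsStep k p q) (hB : IsOwner T p B) (hB' : IsOwner T q B') (hne : B ≠ B') :
    q k ∈ B.faces k ∨ q k ∈ B'.faces k := by
  by_contra! h
  have hqB := (hpq.mem_iff_mem_of_notMem_faces h.1).1 hB.mem_toSet
  have hpB' := (hpq.mem_iff_mem_of_notMem_faces h.2).2 hB'.mem_toSet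
  rcases le_total B.rank B'.rank with hle | hle
  · exact hne (hT.eq_of_rank_le hB' hB.mem hqB hle)
  · exact hne (hT.eq_of_rank_le hB hB'.mem hpB' hle).symm

end Admissible

theorem Cuts.self {B : RankedBox ι} {l u : ℤ} : Cuts i j B p l u k B := Or.inl rfl

theorem Cuts.near {B C : RankedBox ι} {l u : ℤ} (hT : Admissible T D) (hB : IsOwner T p B)
    (hC : C ∈ T) (h : Cuts i j B p l u k C) : C.Near (2 * D) p := by
  have := hT.two_le
  rcases h with rfl | ⟨-, hCB, -⟩
  · exact (hB.near hT).mono (by omega)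
  · exact (hT.near_of_inter_nonempty hB.mem hC hCB (hB.near hT)).mono (by omega)

theorem cutSet_right (hij : i ≠ j) {B : RankedBox ι} {l u l' u' : ℤ} :
    cutSet i j T B p l u j = cutSet i j T B p l' u' j := by
  simp only [cutSet, Cuts, hij.symm, false_imp_iff, and_true]

theorem IsOwner.exists_isGap {B : RankedBox ι} (hB : IsOwner T p B) (l u : ℤ) (k : ι) :
    ∃ a b, IsGap (cutSet i j T B p l u k) (p k) a b :=
  IsGap.exists_of_mem_Ico ⟨B, hB.mem, Cuts.self, B.lo_mem_faces k⟩
    ⟨B, hB.mem, Cuts.self, B.hi_mem_faces k⟩ (hB.mem_toSet k)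

theorem Admissible.exists_isCell (hij : i ≠ j) (hT : Admissible T D) (p : ι → ℤ) :
    ∃ E, IsCell i j T p E := by
  obtain ⟨B, hB⟩ := hT.exists_isOwner p
  obtain ⟨l, u, hlu⟩ := hB.exists_isGap (i := i) (j := j) 0 0 j
  choose a b hab using hB.exists_isGap (i := i) (j := j) l u
  have hj := hab j
  rw [cutSet_right hij (l' := 0) (u' := 0)] at hj
  obtain ⟨rfl, rfl⟩ := hlu.unique hj
  exact ⟨⟨a, b⟩, B, hB, hab⟩

theorem IsCell.unique (hij : i ≠ j) (hT : Admissible T D) {E E' : IntBox ι}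
    (h : IsCell i j T p E) (h' : IsCell i j T p E') : E = E' := by
  obtain ⟨B, hB, hE⟩ := h
  obtain ⟨B', hB', hE'⟩ := h'
  obtain rfl := hT.isOwner_unique hB hB'
  have hj := hE j
  rw [cutSet_right hij (l' := E'.lo j) (u' := E'.hi j)] at hj
  obtain ⟨hlo, hhi⟩ := hj.unique (hE' j)
  simp only [hlo, hhi] at hE
  exact IntBox.ext (funext fun k => ((hE k).unique (hE' k)).1)
    (funext fun k => ((hE k).unique (hE' k)).2)

theorem IsCell.mem_toSet {E : IntBox ι} (h : IsCell i j T p E) : p ∈ E.toSet :=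
  let ⟨_, hB⟩ := h
  fun k => (hB.isGap k).mem_Ico

theorem IsCell.add_two_le (hT : Admissible T D) {E : IntBox ι} (h : IsCell i j T p E) (k : ι) :
    E.lo k + 2 ≤ E.hi k := by
  obtain ⟨B, hB⟩ := h
  have := hT.two_le
  have hk := (hB.isGap k).mem_Ico
  rw [Set.mem_Ico] at hk
  obtain ⟨C, hC, hCB, hlo⟩ := (hB.isGap k).left_mem
  obtain ⟨C', hC', hCB', hhi⟩ := (hB.isGap k).right_mem
  by_cases hne : C = C'
  · subst hne
    have := hT.add_two_le C hC k
    rw [IntBox.mem_faces] at hlo hhi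
    omega
  · have := (hT.generic_of_near hC hC' ((hCB.near hT hB.isOwner hC).mono (by omega))
      ((hCB'.near hT hB.isOwner hC').mono (by omega)) hne).2 k _ hlo _ hhi
    rw [abs_sub_comm, abs_of_pos (by omega)] at this
    omega

namespace IsCellOf

variable {B C : RankedBox ι} {E : IntBox ι}

theorem mem_side_iff (h : IsCellOf i j T B p E) (hq : q ∈ E.toSet) (hC : C ∈ T)
    (hCB : Cuts i j B p (E.lo j) (E.hi j) k C) : q k ∈ C.side k ↔ p k ∈ C.side k := by
  have hlo := (h.isGap k).le_iff ⟨C, hC, hCB, C.lo_mem_faces k⟩ (hq k)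
  have hhi := (h.isGap k).le_iff ⟨C, hC, hCB, C.hi_mem_faces k⟩ (hq k)
  rw [IntBox.mem_side, IntBox.mem_side, hlo, ← not_le, hhi, not_le]

theorem mem_owner (h : IsCellOf i j T B p E) (hq : q ∈ E.toSet) : q ∈ B.toSet := fun k =>
  (h.mem_side_iff hq h.isOwner.mem Cuts.self).2 (h.isOwner.mem_toSet k)

theorem mem_side_iff_of_ne (h : IsCellOf i j T B p E) (hq : q ∈ E.toSet) (hC : C ∈ T)
    (hrank : C.rank < B.rank) (hCB : (C.toSet ∩ B.toSet).Nonempty) (hi : k ≠ i) (hj : k ≠ j) :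
    q k ∈ C.side k ↔ p k ∈ C.side k :=
  h.mem_side_iff hq hC
    (Or.inr ⟨hrank, hCB, fun hk => (hj hk).elim, fun hk => (hi hk).elim⟩)

theorem forall_mem_side_iff (hij : i ≠ j) (h : IsCellOf i j T B p E) (hq : q ∈ E.toSet)
    (hC : C ∈ T) (hrank : C.rank < B.rank) (hCB : (C.toSet ∩ B.toSet).Nonempty)
    (hlo : C.lo j ≤ E.hi j) (hhi : E.lo j ≤ C.hi j) :
    (∀ m, m ≠ j → q m ∈ C.side m) ↔ ∀ m, m ≠ j → p m ∈ C.side m := by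
  have hne : ∀ m, m ≠ i → m ≠ j → (q m ∈ C.side m ↔ p m ∈ C.side m) := fun m =>
    h.mem_side_iff_of_ne hq hC hrank hCB
  have hi (hp : ∀ m, m ≠ i → m ≠ j → p m ∈ C.side m) : q i ∈ C.side i ↔ p i ∈ C.side i :=
    h.mem_side_iff hq hC
      (Or.inr ⟨hrank, hCB, fun hk => (hij hk).elim, fun _ => ⟨hp, hlo, hhi⟩⟩)
  constructor
  · intro hqC m hmj
    by_cases hmi : m = i
    · exact hmi ▸ (hi fun m hmi hmj => (hne m hmi hmj).1 (hqC m hmj)).1 (hqC i hij)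
    · exact (hne m hmi hmj).1 (hqC m hmj)
  · intro hpC m hmj
    by_cases hmi : m = i
    · exact hmi ▸ (hi fun m _ hmj => hpC m hmj).2 (hpC i hij)
    · exact (hne m hmi hmj).2 (hpC m hmj)

theorem isOwner_of_mem (hij : i ≠ j) (hT : Admissible T D) (h : IsCellOf i j T B p E)
    (hq : q ∈ E.toSet) : IsOwner T q B := by
  obtain ⟨B', hB'⟩ := hT.exists_isOwner q
  have hqB := h.mem_owner hq
  rcases (hB'.rank_le B h.isOwner.mem hqB).eq_or_lt with heq | hlt
  · rwa [← hT.eq_of_rank_le hB' h.isOwner.mem hqB heq.ge] at hB'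
  have hBB' : (B'.toSet ∩ B.toSet).Nonempty := ⟨q, hB'.mem_toSet, hqB⟩
  have hqE := IntBox.mem_side.1 (hq j)
  have hqB' := IntBox.mem_side.1 (hB'.mem_toSet j)
  have hp := (h.forall_mem_side_iff hij hq hB'.mem hlt hBB' (by omega) (by omega)).1
    fun m _ => hB'.mem_toSet m
  have hpj := (h.mem_side_iff hq hB'.mem
    (Or.inr ⟨hlt, hBB', fun _ => hp, fun hk => (hij hk.symm).elim⟩)).1 (hB'.mem_toSet j)
  have hpB' : p ∈ B'.toSet := fun m => by
    by_cases hm : m = j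
    · exact hm ▸ hpj
    · exact hp m hm
  exact absurd (h.isOwner.rank_le B' hB'.mem hpB') hlt.not_ge

theorem cuts_iff_of_mem (hij : i ≠ j) (h : IsCellOf i j T B p E) (hq : q ∈ E.toSet)
    (hC : C ∈ T) (hk : C.lo k ≤ C.hi k) {x : ℤ} (hx : x ∈ C.faces k)
    (hxE : x ∈ Set.Icc (E.lo k) (E.hi k)) :
    Cuts i j B q (E.lo j) (E.hi j) k C ↔ Cuts i j B p (E.lo j) (E.hi j) k C := by
  refine or_congr_right (and_congr_right fun hrank => and_congr_right fun hCB =>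
    and_congr (forall_congr' ?_) (forall_congr' fun _ => and_congr_left fun _ => ?_))
  · rintro rfl
    rw [IntBox.mem_faces] at hx
    rw [Set.mem_Icc] at hxE
    exact h.forall_mem_side_iff hij hq hC hrank hCB (by omega) (by omega)
  · exact forall_congr' fun m => forall_congr' fun hmi => forall_congr' fun hmj =>
      h.mem_side_iff_of_ne hq hC hrank hCB hmi hmj

theorem of_mem (hij : i ≠ j) (hT : Admissible T D) (h : IsCellOf i j T B p E)
    (hq : q ∈ E.toSet) : IsCellOf i j T B q E where
  isOwner := h.isOwner_of_mem hij hT hq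
  isGap k := by
    have hmem (x : ℤ) (hx : x ∈ Set.Icc (E.lo k) (E.hi k)) :
        x ∈ cutSet i j T B q (E.lo j) (E.hi j) k ↔ x ∈ cutSet i j T B p (E.lo j) (E.hi j) k :=
      exists_congr fun C => and_congr_right fun hC => and_congr_left fun hxC =>
        h.cuts_iff_of_mem hij hq hC (by have := hT.add_two_le C hC k; omega) hxC hx
    have hk := (h.isGap k).mem_Ico
    have hle : E.lo k ≤ E.hi k := hk.1.trans hk.2.le
    exact ⟨(hmem _ (Set.left_mem_Icc.2 hle)).2 (h.isGap k).left_mem,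
      (hmem _ (Set.right_mem_Icc.2 hle)).2 (h.isGap k).right_mem, hq k, fun y hy hyE =>
        (h.isGap k).notMem_Ioo y ((hmem y (Set.Ioo_subset_Icc_self hyE)).1 hy) hyE⟩

end IsCellOf

theorem IsCell.of_mem (hij : i ≠ j) (hT : Admissible T D) {E : IntBox ι}
    (h : IsCell i j T p E) (hq : q ∈ E.toSet) : IsCell i j T q E :=
  let ⟨B, hB⟩ := h
  ⟨B, hB.of_mem hij hT hq⟩

theorem Cuts.vadd_iff {B C : RankedBox ι} (g : ι → ℤ) {l u : ℤ} :
    Cuts i j (g +ᵥ B) (g + p) (g j + l) (g j + u) k (g +ᵥ C) ↔ Cuts i j B p l u k C := by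
  have hCB : ((g +ᵥ C).toSet ∩ (g +ᵥ B).toSet).Nonempty ↔ (C.toSet ∩ B.toSet).Nonempty :=
    ((Equiv.addLeft g).exists_congr fun _ =>
      and_congr IntBox.add_mem_toSet_vadd.symm IntBox.add_mem_toSet_vadd.symm).symm
  unfold Cuts
  rw [hCB]
  simp only [vadd_left_cancel_iff, RankedBox.vadd_rank, Pi.add_apply,
    RankedBox.vadd_toIntBox, IntBox.add_mem_side_vadd, IntBox.vadd_lo, IntBox.vadd_hi,
    add_le_add_iff_left]

theorem IsOwner.vadd {B : RankedBox ι} (g : ι → ℤ) (h : IsOwner T p B) :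
    IsOwner (g +ᵥ T) (g + p) (g +ᵥ B) where
  mem := Set.vadd_mem_vadd_set h.mem
  mem_toSet := IntBox.add_mem_toSet_vadd.2 h.mem_toSet
  rank_le := by
    rintro _ ⟨C, hC, rfl⟩ hp
    exact h.rank_le C hC (IntBox.add_mem_toSet_vadd.1 hp)

theorem IsCell.vadd {E : IntBox ι} (g : ι → ℤ) (h : IsCell i j T p E) :
    IsCell i j (g +ᵥ T) (g + p) (g +ᵥ E) := by
  obtain ⟨B, hB, hE⟩ := h
  refine ⟨g +ᵥ B, hB.vadd g, fun k => (hE k).add_left fun y => ⟨?_, ?_⟩⟩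
  · rintro ⟨_, ⟨C, hC, rfl⟩, hCB, hy⟩
    exact ⟨C, hC, (Cuts.vadd_iff g).1 hCB, IntBox.add_mem_faces_vadd.1 hy⟩
  · rintro ⟨C, hC, hCB, hy⟩
    exact ⟨g +ᵥ C, Set.vadd_mem_vadd_set hC, (Cuts.vadd_iff g).2 hCB,
      IntBox.add_mem_faces_vadd.2 hy⟩

theorem IsOwner.congr {B : RankedBox ι} (hT : Admissible T D) (hT' : Admissible T' D)
    (h : IsOwner T p B) (hTT' : ∀ C : RankedBox ι, C.Near (2 * D) p → (C ∈ T ↔ C ∈ T')) :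
    IsOwner T' p B := by
  have := hT.two_le
  obtain ⟨B', hB'⟩ := hT'.exists_isOwner p
  have hB'T := (hTT' B' ((hB'.near hT').mono (by omega))).2 hB'.mem
  exact ⟨(hTT' B ((h.near hT).mono (by omega))).1 h.mem, h.mem_toSet, fun C hC hp =>
    (h.rank_le B' hB'T hB'.mem_toSet).trans (hB'.rank_le C hC hp)⟩

theorem IsCell.congr {E : IntBox ι} (hT : Admissible T D) (hT' : Admissible T' D)
    (h : IsCell i j T p E)
    (hTT' : ∀ C : RankedBox ι, C.Near (2 * D) p → (C ∈ T ↔ C ∈ T')) : IsCell i j T' p E := by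
  obtain ⟨B, hB, hE⟩ := h
  have hB' := hB.congr hT hT' hTT'
  have hcut (k : ι) :
      cutSet i j T' B p (E.lo j) (E.hi j) k = cutSet i j T B p (E.lo j) (E.hi j) k := by
    ext x
    exact ⟨fun ⟨C, hC, hCB, hx⟩ => ⟨C, (hTT' C (hCB.near hT' hB' hC)).2 hC, hCB, hx⟩,
      fun ⟨C, hC, hCB, hx⟩ => ⟨C, (hTT' C (hCB.near hT hB hC)).1 hC, hCB, hx⟩⟩
  exact ⟨B, hB', fun k => (hcut k).symm ▸ hE k⟩

end Cells

/-! ### Cells meeting a unit square -/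

section Squares

variable {ι : Type*} {i j : ι} {T : Set (RankedBox ι)} {D : ℤ} {p q p' q' : ι → ℤ}
  {B C : RankedBox ι} {E E' : IntBox ι}

namespace IsCellOf

theorem mem_of_isStep_right (hT : Admissible T D) (h : IsCellOf i j T B p E)
    (hq : IsOwner T q B) (hpq : IsStep j p q) : q ∈ E.toSet := by
  have hstep := hpq.eq_add_one
  have hpE := IntBox.mem_side.1 (h.isGap j).mem_Ico
  refine hpq.mem_right_iff.2 ⟨?_, fun m _ => (h.isGap m).mem_Ico⟩
  by_contra hqE
  have hhi : q j = E.hi j := by rw [IntBox.mem_side] at hqE; omega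
  obtain ⟨C, hC, hCB, hqC⟩ := (h.isGap j).right_mem
  rw [← hhi] at hqC
  rcases hCB with rfl | ⟨hrank, -, hline, -⟩
  · exact hpq.not_mem_left_and_mem_right hqC ⟨h.isOwner.mem_toSet, hq.mem_toSet⟩
  · have := hT.add_two_le C hC j
    rcases hpq.mem_or_mem_of_mem_faces (by omega) hqC (hline rfl) with hp | hq'
    · exact hrank.not_ge (h.isOwner.rank_le C hC hp)
    · exact hrank.not_ge (hq.rank_le C hC hq')

theorem exists_cut_of_notMem (h : IsCellOf i j T B p E) (hq : IsOwner T q B)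
    (hpq : IsStep i p q) (hqE : q ∉ E.toSet) :
    ∃ C ∈ T, C.rank < B.rank ∧ (C.toSet ∩ B.toSet).Nonempty ∧ q i ∈ C.faces i ∧
      (∀ m, m ≠ i → m ≠ j → p m ∈ C.side m) ∧ C.lo j ≤ E.hi j ∧ E.lo j ≤ C.hi j := by
  have hstep := hpq.eq_add_one
  have hpE := IntBox.mem_side.1 (h.isGap i).mem_Ico
  have hhi : q i = E.hi i := by
    by_contra hne
    exact hqE (hpq.mem_right_iff.2
      ⟨IntBox.mem_side.2 (by omega), fun m _ => (h.isGap m).mem_Ico⟩)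
  obtain ⟨C, hC, hCB, hqC⟩ := (h.isGap i).right_mem
  rw [← hhi] at hqC
  rcases hCB with rfl | ⟨hrank, hCB, -, hstrip⟩
  · exact (hpq.not_mem_left_and_mem_right hqC ⟨h.isOwner.mem_toSet, hq.mem_toSet⟩).elim
  · exact ⟨C, hC, hrank, hCB, hqC, hstrip rfl⟩

end IsCellOf

/-- The points `p` and `q` are neighbours in the direction of the `k`-th axis. -/
def IsNeighbor {ι : Type*} (k : ι) (p q : ι → ℤ) : Prop := IsStep k p q ∨ IsStep k q p

namespace IsNeighbor

variable {k : ι}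

theorem symm (h : IsNeighbor k p q) : IsNeighbor k q p := Or.symm h

theorem eq_of_ne (h : IsNeighbor k p q) {m : ι} (hm : m ≠ k) : q m = p m := by
  rcases h with h | h
  · exact h.eq_of_ne m hm
  · exact (h.eq_of_ne m hm).symm

theorem near (h : IsNeighbor k p q) {r : ℤ} (hE : E.Near r p) : E.Near (r + 1) q := by
  rcases h with h | h
  · exact h.near_right hE
  · exact h.near_left hE

/-- The larger of the two coordinates is the position of the face separating `p` from `q`. -/
theorem mem_iff_mem_of_notMem_faces (h : IsNeighbor k p q) (hE : max (p k) (q k) ∉ E.faces k) :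
    p ∈ E.toSet ↔ q ∈ E.toSet := by
  rcases h with h | h
  · rw [max_eq_right (by have := h.eq_add_one; omega)] at hE
    exact h.mem_iff_mem_of_notMem_faces hE
  · rw [max_eq_left (by have := h.eq_add_one; omega)] at hE
    exact (h.mem_iff_mem_of_notMem_faces hE).symm

theorem not_mem_and_mem (h : IsNeighbor k p q) (hE : max (p k) (q k) ∈ E.faces k) :
    ¬ (p ∈ E.toSet ∧ q ∈ E.toSet) := by
  rcases h with h | h
  · rw [max_eq_right (by have := h.eq_add_one; omega)] at hE
    exact h.not_mem_left_and_mem_right hE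
  · rw [max_eq_left (by have := h.eq_add_one; omega)] at hE
    exact fun hpq => h.not_mem_left_and_mem_right hE hpq.symm

theorem notMem_side (h : IsNeighbor k p q) (hp : p ∈ E.toSet) (hq : q ∉ E.toSet) :
    q k ∉ E.side k := by
  intro hqk
  refine hq fun m => ?_
  by_cases hm : m = k
  · exact hm ▸ hqk
  · exact (h.eq_of_ne hm).symm ▸ hp m

end IsNeighbor

theorem Admissible.isOwner_eq_of_notMem (hT : Admissible T D) (hpq : IsStep i p q)
    {B' : RankedBox ι} (hB : IsOwner T p B) (hB' : IsOwner T q B') (hC : C ∈ T)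
    (hCp : C.Near (4 * D) p) (hqC : q i ∈ C.faces i) (hp : p ∉ C.toSet) (hq : q ∉ C.toSet) :
    B = B' := by
  have := hT.two_le
  by_contra hne
  rcases hT.mem_faces_or_of_isOwner_ne hpq hB hB' hne with h | h
  · exact hp (hT.eq_of_mem_faces hC hB.mem hCp ((hB.near hT).mono (by omega)) hqC h ▸
      hB.mem_toSet)
  · exact hq (hT.eq_of_mem_faces hC hB'.mem hCp
      ((hpq.near_left (hB'.near hT)).mono (by omega)) hqC h ▸ hB'.mem_toSet)

/-- The cut reaches the line separating the two rows, as the cell does not. -/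
theorem IsCellOf.exists_cut_reaching (hT : Admissible T D) (h : IsCellOf i j T B p E)
    (hq : IsOwner T q B) (hpq : IsStep i p q) (hqE : q ∉ E.toSet) (hpp' : IsNeighbor j p p')
    (hp'E : p' ∉ E.toSet) :
    ∃ C ∈ T, C.rank < B.rank ∧ C.Near (2 * D) p ∧ q i ∈ C.faces i ∧
      (∀ m, m ≠ i → m ≠ j → p m ∈ C.side m) ∧
      (p j < p' j → C.lo j ≤ p' j) ∧ (p' j < p j → p j ≤ C.hi j) := by
  obtain ⟨C, hC, hrank, hCB, hqC, hCp, hlo, hhi⟩ := h.exists_cut_of_notMem hq hpq hqE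
  have hCnear : C.Near (2 * D) p :=
    (hT.near_of_inter_nonempty h.isOwner.mem hC hCB (h.isOwner.near hT)).mono (by omega)
  have hpE : p ∈ E.toSet := fun m => (h.isGap m).mem_Ico
  have hpj := IntBox.mem_side.1 (hpE j)
  have hp'j := hpp'.notMem_side hpE hp'E
  rw [IntBox.mem_side] at hp'j
  have hstep : p' j = p j + 1 ∨ p j = p' j + 1 :=
    hpp'.imp IsStep.eq_add_one IsStep.eq_add_one
  exact ⟨C, hC, hrank, hCnear, hqC, hCp, fun _ => by omega, fun _ => by omega⟩

/-- If the face of a box `B` separates two rows and `B` owns one of them, then a cut between the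
points of each row would come from a common box `C` of lower rank, and `C` would contain a point
owned by `B`. -/
theorem IsCellOf.mem_or_mem_of_isNeighbor (hij : i ≠ j) (hT : Admissible T D)
    (hE : IsCellOf i j T B p E) (hq : IsOwner T q B) (hE' : IsCell i j T p' E')
    (hpq : IsStep i p q) (hpq' : IsStep i p' q') (hp : IsNeighbor j p p')
    (hqq' : IsNeighbor j q q') (hB : max (p j) (p' j) ∈ B.faces j) :
    q ∈ E.toSet ∨ q' ∈ E'.toSet := by
  have := hT.two_le
  by_contra! ⟨hqE, hq'E'⟩
  have hp'B : p' ∉ B.toSet := fun h => hp.not_mem_and_mem hB ⟨hE.isOwner.mem_toSet, h⟩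
  obtain ⟨C, hC, hrank, hCp, hqC, hCrow, hCj, hCj'⟩ := hE.exists_cut_reaching hT hq hpq hqE hp
    fun h => hp'B (hE.mem_owner h)
  have hface : max (p j) (p' j) ∉ C.faces j := fun h => hrank.ne <| congrArg RankedBox.rank <|
    hT.eq_of_mem_faces hC hE.isOwner.mem (hCp.mono (by omega))
      ((hE.isOwner.near hT).mono (by omega)) h hB
  have hpC : p ∉ C.toSet := fun h => hrank.not_ge (hE.isOwner.rank_le C hC h)
  have hqC' : q ∉ C.toSet := fun h => hrank.not_ge (hq.rank_le C hC h)
  have hp'C : p' ∉ C.toSet := mt (hp.mem_iff_mem_of_notMem_faces hface).2 hpC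
  have hq'C : q' ∉ C.toSet := by
    rw [← hpq.eq_of_ne j hij.symm, ← hpq'.eq_of_ne j hij.symm] at hface
    exact mt (hqq'.mem_iff_mem_of_notMem_faces hface).2 hqC'
  obtain ⟨B', hE'⟩ := hE'
  obtain ⟨B'', hB''⟩ := hT.exists_isOwner q'
  obtain rfl : B' = B'' := hT.isOwner_eq_of_notMem hpq' hE'.isOwner hB'' hC
    ((hp.near hCp).mono (by omega)) (hqq'.eq_of_ne hij ▸ hqC) hp'C hq'C
  have hpE' : p ∉ E'.toSet := fun h => hp'B <|
    hT.isOwner_unique (hE'.isOwner_of_mem hij hT h) hE.isOwner ▸ hE'.isOwner.mem_toSet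
  obtain ⟨C', hC', -, hC'p', hq'C', -, hC'j, hC'j'⟩ :=
    hE'.exists_cut_reaching hT hB'' hpq' hq'E' hp.symm hpE'
  obtain rfl : C' = C := hT.eq_of_mem_faces hC' hC ((hp.symm.near hC'p').mono (by omega))
    (hCp.mono (by omega)) (hqq'.eq_of_ne hij ▸ hq'C') hqC
  have hpj : p j ∈ C'.side j := by
    have hstep : p' j = p j + 1 ∨ p j = p' j + 1 := hp.imp IsStep.eq_add_one IsStep.eq_add_one
    rw [IntBox.mem_faces] at hface
    rw [IntBox.mem_side]
    omega
  have := hT.add_two_le C' hC i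
  refine (hpq.mem_or_mem_of_mem_faces (by omega) hqC fun m hmi => ?_).elim hpC hqC'
  by_cases hmj : m = j
  · exact hmj ▸ hpj
  · exact hCrow m hmi hmj

theorem IsCellOf.mem_faces_or_of_notMem (hT : Admissible T D) {B' : RankedBox ι}
    (hE : IsCellOf i j T B p E) (hB' : IsOwner T p' B') (hpp' : IsStep j p p')
    (hp'E : p' ∉ E.toSet) : p' j ∈ B.faces j ∨ p' j ∈ B'.faces j :=
  hT.mem_faces_or_of_isOwner_ne hpp' hE.isOwner hB' fun h =>
    hp'E (hE.mem_of_isStep_right hT (h ▸ hB') hpp')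

/-- The points `p, q, p', q'` are the corners of a unit square parallel to the `i, j`-plane. -/
structure IsSquare {ι : Type*} (i j : ι) (p q p' q' : ι → ℤ) : Prop where
  bottom : IsStep i p q
  top : IsStep i p' q'
  left : IsStep j p p'
  right : IsStep j q q'

/-- If the same line separates the rows of both columns, then it carries a face of one box, as
nearby boxes have no faces in common. -/
theorem IsSquare.owner_eq_of_mem_faces (hij : i ≠ j) (hT : Admissible T D)
    (h : IsSquare i j p q p' q') {A A' B' : RankedBox ι} (hB : IsOwner T p B)
    (hA : IsOwner T q A) (hB' : IsOwner T p' B') (hA' : IsOwner T q' A')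
    (hleft : p' j ∈ B.faces j ∨ p' j ∈ B'.faces j)
    (hright : p' j ∈ A.faces j ∨ p' j ∈ A'.faces j) :
    (B = A ∧ p' j ∈ B.faces j) ∨ (B' = A' ∧ p' j ∈ B'.faces j) := by
  have := hT.two_le
  have hBnear := (hB.near hT).mono (show D ≤ 4 * D by omega)
  have hAnear := (h.bottom.near_left (hA.near hT)).mono (show D + 1 ≤ 4 * D by omega)
  have hB'near := (h.left.near_left (hB'.near hT)).mono (show D + 1 ≤ 4 * D by omega)
  have hA'near :=
    (h.left.near_left (h.top.near_left (hA'.near hT))).mono (show D + 1 + 1 ≤ 4 * D by omega)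
  have hqj : q j = p j := h.bottom.eq_of_ne j hij.symm
  have hq'j : q' j = p' j := h.top.eq_of_ne j hij.symm
  have hpj := h.left.eq_add_one
  have hpB := IntBox.mem_side.1 (hB.mem_toSet j)
  have hqA := IntBox.mem_side.1 (hA.mem_toSet j)
  have hp'B' := IntBox.mem_side.1 (hB'.mem_toSet j)
  have hq'A' := IntBox.mem_side.1 (hA'.mem_toSet j)
  rcases hleft with hYB | hYB' <;> rcases hright with hYA | hYA'
  · exact Or.inl ⟨hT.eq_of_mem_faces hB.mem hA.mem hBnear hAnear hYB hYA, hYB⟩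
  · obtain rfl := hT.eq_of_mem_faces hB.mem hA'.mem hBnear hA'near hYB hYA'
    rw [IntBox.mem_faces] at hYB
    omega
  · obtain rfl := hT.eq_of_mem_faces hB'.mem hA.mem hB'near hAnear hYB' hYA
    rw [IntBox.mem_faces] at hYB'
    omega
  · exact Or.inr ⟨hT.eq_of_mem_faces hB'.mem hA'.mem hB'near hA'near hYB' hYA', hYB'⟩

theorem IsSquare.mem_cell_of_isCell (hij : i ≠ j) (hT : Admissible T D)
    (h : IsSquare i j p q p' q') {F : IntBox ι} (hE : IsCell i j T p E) (hF : IsCell i j T q F)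
    (hE' : IsCell i j T p' E') :
    q ∈ E.toSet ∨ p' ∈ E.toSet ∨ q' ∈ F.toSet ∨ q' ∈ E'.toSet := by
  by_contra! ⟨hqE, hp'E, hq'F, hq'E'⟩
  obtain ⟨B, hB⟩ := id hE
  obtain ⟨A, hA⟩ := hF
  obtain ⟨B', hB'⟩ := id hE'
  obtain ⟨A', hA'⟩ := hT.exists_isOwner q'
  have hq'j : q' j = p' j := h.top.eq_of_ne j hij.symm
  have hmax : max (p j) (p' j) = p' j := max_eq_right (by have := h.left.eq_add_one; omega)
  have hleft := hB.mem_faces_or_of_notMem hT hB'.isOwner h.left hp'E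
  have hright := hq'j ▸ hA.mem_faces_or_of_notMem hT hA' h.right hq'F
  rcases h.owner_eq_of_mem_faces hij hT hB.isOwner hA.isOwner hB'.isOwner hA' hleft hright with
    ⟨rfl, hface⟩ | ⟨rfl, hface⟩
  · exact (hB.mem_or_mem_of_isNeighbor hij hT hA.isOwner hE' h.bottom h.top (Or.inl h.left)
      (Or.inl h.right) (by rwa [hmax])).elim hqE hq'E'
  · exact (hB'.mem_or_mem_of_isNeighbor hij hT hA' hE h.top h.bottom (Or.inr h.left)
      (Or.inr h.right) (by rwa [max_comm, hmax])).elim hq'E' hqE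

theorem IsCell.eq_of_mem (hij : i ≠ j) (hT : Admissible T D) {cell : (ι → ℤ) → IntBox ι}
    (hcell : ∀ p, IsCell i j T p (cell p)) (hq : q ∈ (cell p).toSet) : cell q = cell p :=
  (hcell q).unique hij hT ((hcell p).of_mem hij hT hq)

section Square

variable [DecidableEq ι]

theorem isStep_add_single (k : ι) (p : ι → ℤ) : IsStep k p (p + Pi.single k 1) where
  eq_add_one := by simp only [Pi.add_apply, Pi.single_eq_same]
  eq_of_ne m hm := by simp only [Pi.add_apply, Pi.single_eq_of_ne hm, add_zero]

theorem isSquare_add_single (i j : ι) (p : ι → ℤ) :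
    IsSquare i j p (p + Pi.single i 1) (p + Pi.single j 1)
      (p + Pi.single i 1 + Pi.single j 1) where
  bottom := isStep_add_single i p
  top := add_right_comm p (Pi.single i 1) _ ▸ isStep_add_single i _
  left := isStep_add_single j p
  right := isStep_add_single j _

theorem Icc_add_single_add_single_subset (hij : i ≠ j) (p : ι → ℤ) :
    Set.Icc p (p + Pi.single i 1 + Pi.single j 1) ⊆
      {p, p + Pi.single i 1, p + Pi.single j 1, p + Pi.single i 1 + Pi.single j 1} := by
  rintro r ⟨hpr, hrp⟩
  have hi : r i = p i ∨ r i = p i + 1 := by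
    have hpri : p i ≤ r i := hpr i
    have := hrp i
    simp only [Pi.add_apply, Pi.single_eq_same, Pi.single_eq_of_ne hij, add_zero] at this
    omega
  have hj : r j = p j ∨ r j = p j + 1 := by
    have hprj : p j ≤ r j := hpr j
    have := hrp j
    simp only [Pi.add_apply, Pi.single_eq_same, Pi.single_eq_of_ne hij.symm, add_zero] at this
    omega
  have hne (m : ι) (hmi : m ≠ i) (hmj : m ≠ j) : r m = p m := by
    have := hrp m
    simp only [Pi.add_apply, Pi.single_eq_of_ne hmi, Pi.single_eq_of_ne hmj, add_zero] at this
    exact this.antisymm (hpr m)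
  have hr : r = p + Pi.single i (r i - p i) + Pi.single j (r j - p j) := by
    ext m
    by_cases hmi : m = i
    · subst hmi; simp [hij]
    by_cases hmj : m = j
    · subst hmj; simp [hmi]
    · simp [hmi, hmj, hne]
  rw [hr]
  rcases hi with hi | hi <;> rcases hj with hj | hj <;> simp [hi, hj]

theorem encard_cells_of_square_le (hij : i ≠ j) (hT : Admissible T D)
    {cell : (ι → ℤ) → IntBox ι} (hcell : ∀ p, IsCell i j T p (cell p)) (p : ι → ℤ) :
    (cell '' Set.Icc p (p + Pi.single i 1 + Pi.single j 1)).encard ≤ 3 := by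
  refine (Set.encard_le_encard (Set.image_mono (Icc_add_single_add_single_subset hij p))).trans ?_
  have h := (isSquare_add_single i j p).mem_cell_of_isCell hij hT (hcell p) (hcell _) (hcell _)
  have htriple (a b c : IntBox ι) : ({a, b, c} : Set (IntBox ι)).encard ≤ 3 := by
    classical
    rw [← Finset.coe_singleton, ← Finset.coe_insert, ← Finset.coe_insert,
      Set.encard_coe_eq_coe_finsetCard]
    exact_mod_cast Finset.card_le_three
  simp only [Set.image_insert_eq, Set.image_singleton]
  rcases h with h | h | h | h <;> rw [IsCell.eq_of_mem hij hT hcell h]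
  · rw [Set.insert_eq_of_mem (Set.mem_insert _ _)]
    exact htriple _ _ _
  · rw [Set.insert_comm (cell (p + Pi.single i 1)), Set.insert_eq_of_mem (Set.mem_insert _ _)]
    exact htriple _ _ _
  · rw [Set.pair_comm (cell (p + Pi.single j 1)),
      Set.insert_eq_of_mem (a := cell (p + Pi.single i 1)) (Set.mem_insert _ _)]
    exact htriple _ _ _
  · rw [Set.pair_eq_singleton]
    exact htriple _ _ _

end Square

end Squares

/-! ### From partitions of `ℤⁿ` to partitions of `ℝⁿ` -/

theorem isPartition_range {α : Type*} {f : α → Set α} (hself : ∀ x, x ∈ f x)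
    (hmem : ∀ x, ∀ y ∈ f x, f y = f x) : Setoid.IsPartition (Set.range f) := by
  refine ⟨?_, fun x => ⟨f x, ⟨⟨x, rfl⟩, hself x⟩, ?_⟩⟩
  · rintro ⟨x, hx⟩
    exact Set.notMem_empty x (hx ▸ hself x)
  · rintro _ ⟨⟨y, rfl⟩, hx⟩
    exact (hmem y x hx).symm

section Cubes

variable {n : ℕ}

theorem mem_cube {p : Fin n → ℤ} {x : Fin n → ℝ} :
    x ∈ cube p ↔ ∀ k, (p k : ℝ) - 1 / 2 ≤ x k ∧ x k ≤ p k + 1 / 2 := by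
  simp only [cube, Set.mem_Icc, Pi.le_def, forall_and]

theorem mem_cube_ceil (x : Fin n → ℝ) : x ∈ cube fun k => ⌈x k - 1 / 2⌉ :=
  mem_cube.2 fun k => ⟨by linarith [Int.ceil_lt_add_one (x k - 1 / 2)],
    by linarith [Int.le_ceil (x k - 1 / 2)]⟩

theorem mem_Icc_of_mem_cube {p : Fin n → ℤ} {x : Fin n → ℝ} (h : x ∈ cube p) :
    p ∈ Set.Icc (fun k => ⌈x k - 1 / 2⌉) ((fun k => ⌈x k - 1 / 2⌉) + 1) := by
  have hk (k : Fin n) : ⌈x k - 1 / 2⌉ ≤ p k ∧ p k ≤ ⌈x k - 1 / 2⌉ + 1 := by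
    obtain ⟨hlo, hhi⟩ := mem_cube.1 h k
    refine ⟨Int.ceil_le.2 (by linarith), ?_⟩
    have : (p k : ℝ) ≤ (⌈x k - 1 / 2⌉ + 1 : ℤ) := by
      push_cast
      linarith [Int.le_ceil (x k - 1 / 2)]
    exact_mod_cast this
  exact ⟨fun k => (hk k).1, fun k => (hk k).2⟩

theorem cubes_Icc {a b : Fin n → ℤ} (hab : a ≤ b) :
    cubes (Set.Icc a b) = Set.Icc (fun k => (a k : ℝ) - 1 / 2) (fun k => (b k : ℝ) + 1 / 2) := by
  ext x
  simp only [cubes, Set.mem_iUnion₂, exists_prop]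
  constructor
  · rintro ⟨p, ⟨hap, hpb⟩, hx⟩
    have hx := mem_cube.1 hx
    refine ⟨fun k => ?_, fun k => ?_⟩
    · have : (a k : ℝ) ≤ p k := by exact_mod_cast hap k
      linarith [hx k]
    · have : (p k : ℝ) ≤ b k := by exact_mod_cast hpb k
      linarith [hx k]
  · rintro ⟨hax, hxb⟩
    refine ⟨a ⊔ fun k => ⌈x k - 1 / 2⌉, ⟨le_sup_left, sup_le hab fun k => ?_⟩,
      mem_cube.2 fun k => ?_⟩
    · exact Int.ceil_le.2 (by linarith [hxb k])
    · have := hax k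
      have := mem_cube.1 (mem_cube_ceil x) k
      rcases le_total (a k) ⌈x k - 1 / 2⌉ with h | h
      · rwa [Pi.sup_apply, sup_of_le_right h]
      · have : (⌈x k - 1 / 2⌉ : ℝ) ≤ a k := by exact_mod_cast h
        rw [Pi.sup_apply, sup_of_le_left h]
        constructor <;> linarith

theorem interior_cubes_inter_eq_empty {a b a' b' : Fin n → ℤ} (hab : a ≤ b) (hab' : a' ≤ b')
    (h : Disjoint (Set.Icc a b) (Set.Icc a' b')) :
    interior (cubes (Set.Icc a b)) ∩ interior (cubes (Set.Icc a' b')) = ∅ := by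
  have hlt {l u : Fin n → ℤ} (hlu : l ≤ u) {x : Fin n → ℝ}
      (hx : x ∈ interior (cubes (Set.Icc l u))) (k : Fin n) :
      (l k : ℝ) - 1 / 2 < x k ∧ x k < u k + 1 / 2 := by
    rw [cubes_Icc hlu, ← Set.pi_univ_Icc, interior_pi_set Set.finite_univ] at hx
    simpa only [interior_Icc, Set.mem_Ioo] using hx k (Set.mem_univ k)
  have hle {l u : ℤ} {t : ℝ} (hl : (l : ℝ) - 1 / 2 < t) (hu : t < u + 1 / 2) : l ≤ u := by
    have : (l : ℝ) < u + 1 := by linarith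
    exact Int.lt_add_one_iff.1 (by exact_mod_cast this)
  rw [Set.eq_empty_iff_forall_notMem]
  rintro x ⟨hx, hx'⟩
  exact Set.disjoint_left.1 h
    (show a ⊔ a' ∈ Set.Icc a b from
      ⟨le_sup_left, sup_le hab fun k => hle (hlt hab' hx' k).1 (hlt hab hx k).2⟩)
    ⟨le_sup_right, sup_le (fun k => hle (hlt hab hx k).1 (hlt hab' hx' k).2) hab'⟩

theorem one_half_lt_abs_sub_of_half_integers {r s : ℝ}
    (hr : r ∈ Set.range fun m : ℤ => (m : ℝ) + 1 / 2)
    (hs : s ∈ Set.range fun m : ℤ => (m : ℝ) + 1 / 2) (hne : r ≠ s) : 1 / 2 < |r - s| := by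
  obtain ⟨m, rfl⟩ := hr
  obtain ⟨m', rfl⟩ := hs
  have hmm' : m - m' ≠ 0 := fun h => hne (by rw [sub_eq_zero.1 h])
  have : (1 : ℝ) ≤ |((m - m' : ℤ) : ℝ)| := by exact_mod_cast Int.one_le_abs hmm'
  rw [add_sub_add_right_eq_sub, ← Int.cast_sub]
  linarith

theorem IsRectangularPartition.isRegulatedPartitionReal {C : Set (Set (Fin n → ℤ))}
    (hC : IsRectangularPartition C) : IsRegulatedPartitionReal (cubes '' C) := by
  refine ⟨⟨Set.range fun m : ℤ => (m : ℝ) + 1 / 2, 1 / 2, by norm_num,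
    fun r hr s hs => one_half_lt_abs_sub_of_half_integers hr hs, ?_⟩, fun x => ?_, ?_⟩
  · rintro _ ⟨S, hS, rfl⟩
    obtain ⟨a, b, hab, rfl⟩ := hC.2 S hS
    refine ⟨_, _, fun k => ⟨⟨a k - 1, ?_⟩, ⟨b k, rfl⟩, ?_⟩, cubes_Icc fun k => (hab k).le⟩
    · push_cast
      ring
    · have : (a k : ℝ) < b k := by exact_mod_cast hab k
      linarith
  · obtain ⟨S, ⟨hS, hxS⟩, -⟩ := hC.1.2 fun k => ⌈x k - 1 / 2⌉
    exact ⟨_, ⟨S, hS, rfl⟩, Set.mem_biUnion hxS (mem_cube_ceil x)⟩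
  · rintro _ ⟨S, hS, rfl⟩ _ ⟨S', hS', rfl⟩ hne
    have hdisj := hC.1.pairwiseDisjoint hS hS' fun h => hne (congrArg cubes h)
    obtain ⟨a, b, hab, rfl⟩ := hC.2 S hS
    obtain ⟨a', b', hab', rfl⟩ := hC.2 S' hS'
    exact interior_cubes_inter_eq_empty (fun k => (hab k).le) (fun k => (hab' k).le) hdisj

end Cubes

section Covering

theorem single_add_single_apply {ι : Type*} [DecidableEq ι] {i j : ι} (hij : i ≠ j) (k : ι) :
    (Pi.single i 1 + Pi.single j 1 : ι → ℤ) k = if k ∈ ({i, j} : Finset ι) then 1 else 0 := by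
  by_cases hi : k = i
  · simp [hi, hij]
  · by_cases hj : k = j
    · simp [hj, hij.symm]
    · simp [hi, hj]

variable {ι : Type*} [Fintype ι] [DecidableEq ι]

theorem Icc_add_subset_biUnion {v w : ι → ℤ} (hv : 0 ≤ v) (hvw : v ≤ w) (q : ι → ℤ) :
    Set.Icc q (q + w) ⊆ ⋃ p ∈ Finset.Icc q (q + (w - v)), Set.Icc p (p + v) := by
  intro r hr
  have hk (k : ι) : q k ≤ r k ∧ r k ≤ q k + w k ∧ 0 ≤ v k ∧ v k ≤ w k :=
    ⟨hr.1 k, hr.2 k, hv k, hvw k⟩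
  refine Set.mem_biUnion (x := r ⊓ (q + (w - v)))
    (Finset.coe_Icc q _ ▸ ⟨fun k => ?_, inf_le_right⟩) ⟨inf_le_left, fun k => ?_⟩ <;>
  · have := hk k
    simp only [Pi.inf_apply, Pi.add_apply, Pi.sub_apply]
    omega

theorem encard_image_Icc_add_le {β : Type*} {F : (ι → ℤ) → β} {v w : ι → ℤ} {m : ℕ}
    (hv : 0 ≤ v) (hvw : v ≤ w) (hF : ∀ p, (F '' Set.Icc p (p + v)).encard ≤ m) (q : ι → ℤ) :
    (F '' Set.Icc q (q + w)).encard ≤ (Finset.Icc q (q + (w - v))).card * m := by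
  calc (F '' Set.Icc q (q + w)).encard
      ≤ (⋃ p ∈ Finset.Icc q (q + (w - v)), F '' Set.Icc p (p + v)).encard := by
        rw [← Set.image_iUnion₂]
        exact Set.encard_le_encard (Set.image_mono (Icc_add_subset_biUnion hv hvw q))
    _ ≤ ∑ p ∈ Finset.Icc q (q + (w - v)), (F '' Set.Icc p (p + v)).encard :=
        Finset.set_encard_biUnion_le _ _
    _ ≤ (Finset.Icc q (q + (w - v))).card * m := by
        rw [← nsmul_eq_mul]
        exact Finset.sum_le_card_nsmul _ _ _ fun p _ => hF p

theorem card_Icc_add_one_sub {i j : ι} (hij : i ≠ j) (q : ι → ℤ) :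
    (Finset.Icc q (q + (1 - (Pi.single i 1 + Pi.single j 1)))).card =
      2 ^ (Fintype.card ι - 2) := by
  have hk (k : ι) : (Finset.Icc (q k) ((q + (1 - (Pi.single i 1 + Pi.single j 1)) : ι → ℤ) k)).card
      = if k ∈ ({i, j} : Finset ι) then 1 else 2 := by
    rw [Int.card_Icc, Pi.add_apply, Pi.sub_apply, single_add_single_apply hij, Pi.one_apply]
    split_ifs <;> omega
  rw [Pi.card_Icc, Finset.prod_congr rfl fun k _ => hk k, Finset.prod_ite, Finset.prod_const_one,
    one_mul, Finset.prod_const, ← Finset.card_pair hij, ← Finset.card_compl,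
    Finset.filter_notMem_eq_sdiff, Finset.compl_eq_univ_sdiff]

end Covering

/-- The vertices of a unit cube are those of `2 ^ (n - 2)` unit squares parallel to the
`i, j`-plane. -/
theorem isGammaRegulatedInt_range {n : ℕ} {i j : Fin n} (hij : i ≠ j)
    {cell : (Fin n → ℤ) → Set (Fin n → ℤ)} (hrect : ∀ p, IsRectangle (cell p))
    (hself : ∀ p, p ∈ cell p) (hmem : ∀ p, ∀ q ∈ cell p, cell q = cell p)
    (hsquare : ∀ p, (cell '' Set.Icc p (p + (Pi.single i 1 + Pi.single j 1))).encard ≤ 3) :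
    IsGammaRegulatedInt (3 * 2 ^ (n - 2)) (Set.range cell) := by
  have hC : IsRectangularPartition (Set.range cell) :=
    ⟨isPartition_range hself hmem, Set.forall_mem_range.2 hrect⟩
  refine ⟨hC, hC.isRegulatedPartitionReal, fun x => ?_⟩
  let c : Fin n → ℤ := fun k => ⌈x k - 1 / 2⌉
  have hsub : {R ∈ cubes '' Set.range cell | x ∈ R} ⊆ cubes '' (cell '' Set.Icc c (c + 1)) := by
    rintro _ ⟨⟨_, ⟨p, rfl⟩, rfl⟩, hx⟩
    obtain ⟨r, hr, hxr⟩ := Set.mem_iUnion₂.1 hx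
    exact ⟨_, ⟨r, mem_Icc_of_mem_cube hxr, hmem p r hr⟩, rfl⟩
  have hv : (0 : Fin n → ℤ) ≤ Pi.single i 1 + Pi.single j 1 := fun k => by
    rw [single_add_single_apply hij, Pi.zero_apply]
    split_ifs <;> norm_num
  have hv1 : (Pi.single i 1 + Pi.single j 1 : Fin n → ℤ) ≤ 1 := fun k => by
    rw [single_add_single_apply hij, Pi.one_apply]
    split_ifs <;> norm_num
  calc _ ≤ (cell '' Set.Icc c (c + 1)).encard :=
        (Set.encard_le_encard hsub).trans (Set.encard_image_le _ _)
    _ ≤ (2 ^ (n - 2) : ℕ) * (3 : ℕ) := by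
        refine (encard_image_Icc_add_le hv hv1 hsquare c).trans_eq ?_
        rw [card_Icc_add_one_sub hij, Fintype.card_fin]
    _ = (3 * 2 ^ (n - 2) : ℕ) := by
        push_cast
        rw [mul_comm]

/-! ### Tilings of orbits -/

section Boxes

variable {ι X : Type*} [AddAction (ι → ℤ) X] {N : ℕ} {c : X → ℕ} {f : X → Option (IntBox ι)}

/-- The boxes at the markers on the orbit of `x`, in the coordinates in which `x` is the origin.
The rank of a box is the colour of its marker. -/
def boxes (c : X → ℕ) (f : X → Option (IntBox ι)) (x : X) : Set (RankedBox ι) :=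
  {C | ∃ (m : ι → ℤ) (E : IntBox ι), f (m +ᵥ x) = some E ∧ C = ⟨m +ᵥ E, c (m +ᵥ x)⟩}

theorem vadd_boxes (g : ι → ℤ) (x : X) : g +ᵥ boxes c f (g +ᵥ x) = boxes c f x := by
  ext C
  rw [Set.mem_vadd_set_iff_neg_vadd_mem]
  constructor
  · rintro ⟨m, E, hE, hC⟩
    rw [vadd_vadd] at hE hC
    refine ⟨m + g, E, hE, ?_⟩
    rw [neg_vadd_eq_iff.1 hC, add_comm m g]
    exact congrArg (RankedBox.mk · _) (vadd_vadd g m E)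
  · rintro ⟨m, E, hE, rfl⟩
    have hm : (-g + m) +ᵥ (g +ᵥ x) = m +ᵥ x := by
      rw [vadd_vadd, neg_add_cancel_comm]
    refine ⟨-g + m, E, by rwa [hm], ?_⟩
    rw [hm, add_vadd]
    rfl

variable [TopologicalSpace X]

theorem IsMarking.sub_mem_ball_of_near {r : ℤ} (h : IsMarking N r c f) {m p : ι → ℤ} {s : ℤ} {x : X}
    {E : IntBox ι} (hE : f x = some E) (hnear : (m +ᵥ E).Near s p) :
    m - p ∈ ball ι (s + 2 * N) := by
  intro k
  have := h.surrounds _ _ hE k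
  have hk := hnear k
  rw [IntBox.vadd_lo, Pi.add_apply] at hk
  rw [Pi.sub_apply]
  rw [abs_le] at hk ⊢
  omega

/-- Two boxes whose corners are at distance at most `8 (4 N + 1)` belong to markers at distance at
most `8 (4 N + 1) + N ≤ 41 N`. -/
theorem IsMarking.admissible (hN : 1 ≤ N) (h : IsMarking N (41 * N) c f) (x : X) :
    Admissible (boxes c f x) (4 * N + 1) where
  two_le := by omega
  cover p := by
    obtain ⟨g, hg, E, hE⟩ := h.syndetic (p +ᵥ x)
    rw [vadd_vadd] at hE
    refine ⟨_, ⟨g + p, E, hE, rfl⟩, fun k => ?_⟩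
    have := h.surrounds _ _ hE k
    have hgk := abs_le.1 (hg k)
    simp only [IntBox.mem_side, IntBox.vadd_lo, IntBox.vadd_hi, Pi.add_apply]
    omega
  add_two_le := by
    rintro _ ⟨m, E, hE, rfl⟩ k
    have := h.surrounds _ _ hE k
    simp only [IntBox.vadd_lo, IntBox.vadd_hi, Pi.add_apply]
    omega
  le_add := by
    rintro _ ⟨m, E, hE, rfl⟩ k
    have := h.surrounds _ _ hE k
    simp only [IntBox.vadd_lo, IntBox.vadd_hi, Pi.add_apply]
    omega
  generic := by
    rintro _ ⟨m, E, hE, rfl⟩ _ ⟨m', E', hE', rfl⟩ hne hnear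
    have hm : m' - m ≠ 0 := fun hm => by
      obtain rfl := sub_eq_zero.1 hm
      exact hne (by rw [Option.some_inj.1 (hE.symm.trans hE')])
    have hball : m' - m ∈ ball ι (41 * N) := fun k => by
      have := h.surrounds _ _ hE k
      have := h.surrounds _ _ hE' k
      have hk := hnear k
      simp only [IntBox.vadd_lo, Pi.add_apply] at hk
      rw [Pi.sub_apply]
      rw [abs_le] at hk ⊢
      omega
    have hvadd : (m' - m) +ᵥ (m +ᵥ x) = m' +ᵥ x := by rw [vadd_vadd, sub_add_cancel]
    refine ⟨fun hcolor => h.isProperColoring (m +ᵥ x) _ hball hm (hvadd ▸ hcolor.symm), ?_⟩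
    have := (h.facesApart (m +ᵥ x) _ hball hm E E' hE (hvadd.symm ▸ hE')).vadd m
    rwa [vadd_vadd, add_sub_cancel] at this

open Filter Topology in
theorem IsMarking.eventually_mem_boxes_iff [Finite ι] [ContinuousConstVAdd (ι → ℤ) X] {r : ℤ}
    (h : IsMarking N r c f) (x : X) (s : ℤ) :
    ∀ᶠ y in 𝓝 x, ∀ C : RankedBox ι, C.Near s 0 → (C ∈ boxes c f x ↔ C ∈ boxes c f y) := by
  have hfc : IsLocallyConstant fun x => (f x, c x) :=
    h.isLocallyConstant.prodMk h.isLocallyConstant_color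
  have hball : ∀ᶠ y in 𝓝 x, ∀ m ∈ ball ι (s + 2 * N),
      (f (m +ᵥ y), c (m +ᵥ y)) = (f (m +ᵥ x), c (m +ᵥ x)) :=
    (eventually_all_finite (finite_ball _)).2 fun m _ =>
      (hfc.comp_continuous (continuous_const_vadd m)).eventually_eq x
  filter_upwards [hball] with y hy C hC
  refine exists₂_congr fun m E => ?_
  by_cases hm : m ∈ ball ι (s + 2 * N)
  · obtain ⟨hf, hc⟩ := Prod.mk_inj.1 (hy m hm)
    rw [hf, hc]
  · have hnot (z : X) : ¬ (f (m +ᵥ z) = some E ∧ C = ⟨m +ᵥ E, c (m +ᵥ z)⟩) := by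
      rintro ⟨hE, rfl⟩
      exact hm (sub_zero m ▸ h.sub_mem_ball_of_near hE hC)
    exact iff_of_false (hnot x) (hnot y)

end Boxes

section Tiling

variable {ι X : Type*} [AddAction (ι → ℤ) X] {E : X → IntBox ι} {x : X}

/-- The box `E (p +ᵥ x)`, in the coordinates in which `x` is the origin. -/
def orbitBox (E : X → IntBox ι) (x : X) (p : ι → ℤ) : IntBox ι := p +ᵥ E (p +ᵥ x)

/-- The boxes `E x`, placed at the points `x`, tile the orbits. -/
structure IsTiling (E : X → IntBox ι) : Prop where
  zero_mem : ∀ x, 0 ∈ (E x).toSet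
  orbitBox_eq : ∀ x, ∀ q ∈ (E x).toSet, orbitBox E x q = E x

/-- The part of the orbit of `x` covered by the box `E x` placed at `x`. -/
def tile (E : X → IntBox ι) (x : X) : Set X := (· +ᵥ x) '' (E x).toSet

theorem image_orbitBox (E : X → IntBox ι) (x : X) (p : ι → ℤ) :
    (· +ᵥ x) '' (orbitBox E x p).toSet = tile E (p +ᵥ x) := by
  ext y
  constructor
  · rintro ⟨q, hq, rfl⟩
    refine ⟨-p + q, IntBox.add_mem_toSet_vadd.1 (by rwa [add_neg_cancel_left]), ?_⟩
    simp only [vadd_vadd, neg_add_cancel_comm]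
  · rintro ⟨q, hq, rfl⟩
    refine ⟨p + q, IntBox.add_mem_toSet_vadd.2 hq, ?_⟩
    simp only [vadd_vadd, add_comm]

namespace IsTiling

theorem orbitBox_eq_of_mem (hE : IsTiling E) {p q : ι → ℤ} (hq : q ∈ (orbitBox E x p).toSet) :
    orbitBox E x q = orbitBox E x p := by
  obtain ⟨r, rfl⟩ : ∃ r, q = p + r := ⟨-p + q, (add_neg_cancel_left p q).symm⟩
  have := hE.orbitBox_eq (p +ᵥ x) r (IntBox.add_mem_toSet_vadd.1 hq)
  simp only [orbitBox, vadd_vadd] at this ⊢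
  rw [← this, vadd_vadd, add_comm p r]

theorem mem_tile (hE : IsTiling E) (x : X) : x ∈ tile E x :=
  ⟨0, hE.zero_mem x, zero_vadd _ x⟩

theorem tile_eq_of_mem (hE : IsTiling E) {y : X} (hy : y ∈ tile E x) : tile E y = tile E x := by
  obtain ⟨q, hq, rfl⟩ := hy
  rw [← image_orbitBox, hE.orbitBox_eq x q hq, tile]

theorem isPartition (hE : IsTiling E) : Setoid.IsPartition (Set.range (tile E)) :=
  isPartition_range hE.mem_tile fun _ _ => hE.tile_eq_of_mem

variable [IsCancelVAdd (ι → ℤ) X]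

theorem setOf_image_mem_range_tile (hE : IsTiling E) (x : X) :
    {S : Set (ι → ℤ) | (· +ᵥ x) '' S ∈ Set.range (tile E)} =
      Set.range fun p => (orbitBox E x p).toSet := by
  ext S
  constructor
  · rintro ⟨y, hy⟩
    obtain ⟨p, -, rfl⟩ : y ∈ (· +ᵥ x) '' S := hy ▸ hE.mem_tile y
    refine ⟨p, Set.image_injective.2 (fun _ _ => IsCancelVAdd.right_cancel _ _ x) ?_⟩
    rw [image_orbitBox, hy]
  · rintro ⟨p, rfl⟩
    exact ⟨p +ᵥ x, (image_orbitBox E x p).symm⟩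

theorem isClopen (hE : IsTiling E) [TopologicalSpace X] (hconst : IsLocallyConstant E)
    (g : ι → ℤ) : IsClopen {x | ∃ A ∈ Set.range (tile E), x ∈ A ∧ g +ᵥ x ∈ A} := by
  have hset : {x | ∃ A ∈ Set.range (tile E), x ∈ A ∧ g +ᵥ x ∈ A} = E ⁻¹' {F | g ∈ F.toSet} := by
    ext x
    constructor
    · rintro ⟨_, ⟨y, rfl⟩, hx, hgx⟩
      rw [← hE.tile_eq_of_mem hx] at hgx
      obtain ⟨q, hq, hqx⟩ := hgx
      exact IsCancelVAdd.right_cancel _ _ x hqx ▸ hq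
    · exact fun hg => ⟨tile E x, ⟨x, rfl⟩, hE.mem_tile x, g, hg, rfl⟩
  rw [hset]
  exact ⟨⟨hconst {F | g ∈ F.toSet}ᶜ⟩, hconst {F | g ∈ F.toSet}⟩

end IsTiling

theorem IsMarking.exists_isTiling [Finite ι] [DecidableEq ι] [TopologicalSpace X]
    [ContinuousConstVAdd (ι → ℤ) X] {N : ℕ} {c : X → ℕ} {f : X → Option (IntBox ι)} (hN : 1 ≤ N)
    (h : IsMarking N (41 * N) c f) {i j : ι} (hij : i ≠ j) :
    ∃ E : X → IntBox ι, IsLocallyConstant E ∧ IsTiling E ∧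
      (∀ x k, (E x).lo k + 2 ≤ (E x).hi k) ∧
      ∀ x p, (orbitBox E x '' Set.Icc p (p + Pi.single i 1 + Pi.single j 1)).encard ≤ 3 := by
  have hT := h.admissible hN
  choose E hE using fun x => (hT x).exists_isCell hij 0
  have hcell (x : X) (p : ι → ℤ) : IsCell i j (boxes c f x) p (orbitBox E x p) := by
    have := (hE (p +ᵥ x)).vadd p
    rwa [vadd_boxes, add_zero] at this
  refine ⟨E, ?_, ⟨fun x => (hE x).mem_toSet, fun x q hq => ?_⟩, fun x => (hE x).add_two_le (hT x),
    fun x => encard_cells_of_square_le hij (hT x) (hcell x)⟩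
  · rw [IsLocallyConstant.iff_eventually_eq]
    intro x
    filter_upwards [h.eventually_mem_boxes_iff x (2 * (4 * N + 1))] with y hy
    exact (hE y).unique hij (hT y) ((hE x).congr (hT x) (hT y) hy)
  · exact (hcell x q).unique hij (hT x) ((hE x).of_mem hij (hT x) hq)

theorem IntBox.isRectangle_toSet {n : ℕ} {E : IntBox (Fin n)} (h : ∀ k, E.lo k + 2 ≤ E.hi k) :
    IsRectangle E.toSet :=
  ⟨E.lo, E.hi - 1, fun k => by
    have := h k
    rw [Pi.sub_apply, Pi.one_apply]
    omega, E.toSet_eq_Icc⟩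

theorem IsTiling.isGammaRegulatedInt {n : ℕ} {X : Type*} [AddAction (Fin n → ℤ) X]
    [IsCancelVAdd (Fin n → ℤ) X] {E : X → IntBox (Fin n)} (hE : IsTiling E) {i j : Fin n}
    (hij : i ≠ j) (hside : ∀ x k, (E x).lo k + 2 ≤ (E x).hi k)
    (hsquare : ∀ x p,
      (orbitBox E x '' Set.Icc p (p + Pi.single i 1 + Pi.single j 1)).encard ≤ 3) (x : X) :
    IsGammaRegulatedInt (3 * 2 ^ (n - 2))
      {S : Set (Fin n → ℤ) | (· +ᵥ x) '' S ∈ Set.range (tile E)} := by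
  rw [hE.setOf_image_mem_range_tile]
  refine isGammaRegulatedInt_range hij (fun p => ?_) (fun p => ?_) (fun p q hq => ?_) fun p => ?_
  · exact IntBox.isRectangle_toSet fun k => by
      have := hside (p +ᵥ x) k
      simp only [orbitBox, IntBox.vadd_lo, IntBox.vadd_hi, Pi.add_apply]
      omega
  · have := (IntBox.add_mem_toSet_vadd (g := p)).2 (hE.zero_mem (p +ᵥ x))
    rwa [add_zero] at this
  · rw [hE.orbitBox_eq_of_mem hq]
  · rw [← add_assoc, ← Set.image_image]
    exact (Set.encard_image_le _ _).trans (hsquare x p)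

end Tiling

/-! ### The free part of the Bernoulli shift -/

section FreePart

variable {n : ℕ}

theorem act_act (g h : Fin n → ℤ) (z : FreePart n) : act g (act h z) = act (g + h) z :=
  Subtype.ext (shift_shift g h z.1)

theorem act_zero (z : FreePart n) : act 0 z = z :=
  Subtype.ext (funext fun h => congrArg z.1 (add_zero h))

theorem eq_zero_of_act_eq {g : Fin n → ℤ} {z : FreePart n} (h : act g z = z) : g = 0 :=
  not_not.1 fun hg => z.2 g hg (congrArg Subtype.val h)

theorem continuous_eval (h : Fin n → ℤ) : Continuous fun z : FreePart n => z.1 h :=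
  (continuous_apply h).comp continuous_subtype_val

theorem continuous_act (g : Fin n → ℤ) : Continuous (act g : FreePart n → FreePart n) :=
  Continuous.subtype_mk (continuous_pi fun h => continuous_eval (h + g)) _

instance : TotallySeparatedSpace (FreePart n) :=
  totallySeparatedSpace_iff_exists_isClopen.2 fun z w hzw => by
    obtain ⟨h, hh⟩ := Function.ne_iff.1 (Subtype.coe_ne_coe.2 hzw)
    exact ⟨_, (isClopen_discrete {z.1 h}).preimage (continuous_eval h), rfl, hh.symm⟩

instance : AddAction (Fin n → ℤ) (FreePart n) where
  vadd := act
  zero_vadd := act_zero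
  add_vadd g h z := (act_act g h z).symm

instance : ContinuousConstVAdd (Fin n → ℤ) (FreePart n) where
  continuous_const_vadd := continuous_act

instance : IsCancelVAdd (Fin n → ℤ) (FreePart n) where
  left_cancel' g _ _ h := vadd_left_cancel g h
  right_cancel' g h z hgh := by
    have hz : (g - h) +ᵥ z = z := vadd_left_cancel h (by rw [vadd_vadd, add_sub_cancel, hgh])
    exact sub_eq_zero.1 (eq_zero_of_act_eq hz)

end FreePart

end RegPart

open RegPart in
theorem mainTheorem4_general {n : ℕ} (hn : 2 ≤ n) (X : Type*) [TopologicalSpace X]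
    [TotallySeparatedSpace X] [LindelofSpace X] [AddAction (Fin n → ℤ) X]
    [ContinuousConstVAdd (Fin n → ℤ) X] [IsCancelVAdd (Fin n → ℤ) X] :
    ∃ P : Set (Set X), (Setoid.IsPartition P ∧
        ∀ A ∈ P, ∃ (x : X) (S : Set (Fin n → ℤ)), IsRectangle S ∧ A = (· +ᵥ x) '' S) ∧
      (∀ g : Fin n → ℤ, IsClopen {x | ∃ A ∈ P, x ∈ A ∧ g +ᵥ x ∈ A}) ∧
      ∀ x, IsGammaRegulatedInt (3 * 2 ^ (n - 2)) {S : Set (Fin n → ℤ) | (· +ᵥ x) '' S ∈ P} := by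
  obtain ⟨N, c, f, hN, hmarking⟩ :=
    exists_isMarking (X := X) (ι := Fin n) (ρ := 41) (by norm_num)
  have hij : (⟨0, by omega⟩ : Fin n) ≠ ⟨1, by omega⟩ := by simp
  obtain ⟨E, hconst, hE, hside, hsquare⟩ := hmarking.exists_isTiling hN hij
  refine ⟨Set.range (tile E), ⟨hE.isPartition, ?_⟩, hE.isClopen hconst,
    hE.isGammaRegulatedInt hij hside hsquare⟩
  rintro _ ⟨x, rfl⟩
  exact ⟨x, (E x).toSet, IntBox.isRectangle_toSet (hside x), rfl⟩

theorem mainTheorem4 (n : ℕ) (hn : 2 ≤ n) :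
    ∃ P : Set (Set (RegPart.FreePart n)),
      RegPart.IsClopenPartition P ∧ RegPart.IsGammaRegulated (3 * 2 ^ (n - 2)) P := by
  obtain ⟨P, hP, hclopen, hregulated⟩ := mainTheorem4_general hn (RegPart.FreePart n)
  exact ⟨P, hclopen, hP, hregulated⟩
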